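/- Let $k$ be a field, $n\ge 1$, $\Lambda_n=k[x]/\langle x^n\rangle$, and for an algebra $\Lambda$ let $\mathrm{mod}\,\Lambda$ be the category of $\Lambda$-modules of finite length. Let $\mathcal S(n)$ be the category of monomorphisms $u:X\to Y$ in $\mathrm{mod}\,\Lambda_n$ (a full subcategory of the category of all maps of $\mathrm{mod}\,\Lambda_n$). Let $E=\bigoplus_{i=1}^n[i]$ with $[i]=\Lambda_n/\langle x^i\rangle$, let $A_n=\mathrm{End}(E)^{\mathrm{op}}$ be the Auslander algebra of $\Lambda_n$, and let $e\in A_n$ be the idempotent given by the projection of $E$ onto $[n]$. Let $\Pi_{n-1}$ be the preprojective algebra of type $\mathbb A_{n-1}$ over $k$; it is isomorphic as a $k$-algebra to $A_n/\langle e\rangle$. Fix any $k$-algebra isomorphism $\Pi_{n-1}\cong A_n/\langle e\rangle$ and use it to regard $M/A_neM$, for an $A_n$-module $M$, as a $\Pi_{n-1}$-module. Define functors $F,G:\mathcal S(n)\to\mathrm{mod}\,\Pi_{n-1}$ by $$F(u)=\delta\bigl(\mathrm{Cok}\,\mathrm{Hom}_{\Lambda_n}(E,\,u:X\to Y)\bigr),\qquad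 G(u)=\delta\bigl(\mathrm{Cok}\,\mathrm{Hom}_{\Lambda_n}(E,\,Y\to Y/X)\bigr),\qquad \delta(M)=M/A_neM,$$ where $Y\to Y/X$ is the canonical projection. Let $\pi:\mathrm{mod}\,\Pi_{n-1}\to\underline{\mathrm{mod}}\,\Pi_{n-1}$ be the projection to the stable category, that is, the factor category of $\mathrm{mod}\,\Pi_{n-1}$ modulo the ideal of maps which factor through a projective module. Every module in $\mathrm{mod}\,\Pi_{n-1}$ has a projective cover; let $\Omega:\underline{\mathrm{mod}}\,\Pi_{n-1}\to\underline{\mathrm{mod}}\,\Pi_{n-1}$ be the syzygy functor, which sends a module $M$ to the kernel of a projective cover of $M$ (formed with any choice of projective covers). Then $$\pi F=\Omega\,\pi\, G,$$ that is, the functors $\pi F$ and $\Omega\pi G$ from $\mathcal S(n)$ to $\underline{\mathrm{mod}}\,\Pi_{n-1}$ are naturally isomorphic. -/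

import Mathlib

open CategoryTheory

universe u

noncomputable section

namespace SubmodPreproj

/-! ### Modules of finite length -/

theorem isFiniteLength_of_surjective {R S : Type*} [Ring R] [Ring S] {σ : R →+* S}
    [RingHomSurjective σ] {M N : Type*} [AddCommGroup M] [Module R M] [AddCommGroup N]
    [Module S N] (f : M →ₛₗ[σ] N) (hf : Function.Surjective f) (h : IsFiniteLength R M) :
    IsFiniteLength S N := by
  rw [isFiniteLength_iff_isNoetherian_isArtinian] at h ⊢
  obtain ⟨h1, h2⟩ := h
  refine ⟨isNoetherian_of_surjective f (LinearMap.range_eq_top.mpr hf), ?_⟩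
  have hm : StrictMono (Submodule.comap f) :=
    Monotone.strictMono_of_injective (fun _ _ h => Submodule.comap_mono h)
      (Submodule.comap_injective_of_surjective hf)
  exact hm.wellFoundedLT

/-- The category `mod R` of (left) `R`-modules of finite length. -/
abbrev FLMod (R : Type u) [Ring R] :=
  ObjectProperty.FullSubcategory (fun M : ModuleCat.{u} R => IsFiniteLength R M)

/-- The object of `mod R` given by a module of finite length. -/
abbrev FLMod.of {R : Type u} [Ring R] (M : Type u) [AddCommGroup M] [Module R M]
    (h : IsFiniteLength R M) : FLMod R := ⟨ModuleCat.of R M, h⟩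

/-- The morphism of `mod R` given by a linear map. -/
abbrev FLMod.ofHom {R : Type u} [Ring R] {M N : FLMod R} (f : M.obj →ₗ[R] N.obj) : M ⟶ N :=
  ObjectProperty.homMk (ModuleCat.ofHom f)

/-- The linear map underlying a morphism of `mod R`. -/
abbrev FLMod.lin {R : Type u} [Ring R] {M N : FLMod R} (f : M ⟶ N) : M.obj →ₗ[R] N.obj :=
  f.hom.hom

/-! ### The stable module category and the syzygy functor -/

/-- Two morphisms of `mod R` are identified in the stable category if their difference factors
through a projective module. -/
def stableRel (R : Type u) [Ring R] : HomRel (FLMod R) := fun M N f g =>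
  ∃ (Q : FLMod R) (a : M ⟶ Q) (b : Q ⟶ N), Module.Projective R Q.obj ∧ f = g + a ≫ b

/-- The stable module category of `R`: the factor category of `mod R` modulo the ideal of
morphisms factoring through projective modules. -/
abbrev StableMod (R : Type u) [Ring R] := CategoryTheory.Quotient (stableRel R)

/-- The canonical projection from `mod R` to the stable module category. -/
abbrev stableProj (R : Type u) [Ring R] : FLMod R ⥤ StableMod R :=
  CategoryTheory.Quotient.functor (stableRel R)

/-- A projective cover of `M` in `mod R`: a surjection from a projective module whose kernel is
superfluous. -/
structure ProjCover {R : Type u} [Ring R] (M : FLMod R) where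
  /-- the projective module -/
  P : FLMod R
  /-- the covering map -/
  p : P.obj →ₗ[R] M.obj
  projective : Module.Projective R P.obj
  surjective : Function.Surjective p
  superfluous : ∀ N : Submodule R P.obj, N ⊔ LinearMap.ker p = ⊤ → N = ⊤

namespace ProjCover

variable {R : Type u} [Ring R]

/-- The kernel of a projective cover. -/
def syz {M : FLMod R} (c : ProjCover M) : FLMod R :=
  FLMod.of (LinearMap.ker c.p)
    (c.P.property.of_injective (LinearMap.ker c.p).injective_subtype)

theorem exists_lift {M N : FLMod R} (c : ProjCover M) (d : ProjCover N) (f : M ⟶ N) :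
    ∃ g : c.P.obj →ₗ[R] d.P.obj, d.p ∘ₗ g = FLMod.lin f ∘ₗ c.p :=
  have := c.projective
  Module.projective_lifting_property d.p (FLMod.lin f ∘ₗ c.p) d.surjective

/-- The map induced on kernels by a lift `g` of `f` to projective covers. -/
def syzMap {M N : FLMod R} (c : ProjCover M) (d : ProjCover N) (f : M ⟶ N)
    (g : c.P.obj →ₗ[R] d.P.obj) (h : d.p ∘ₗ g = FLMod.lin f ∘ₗ c.p) : c.syz ⟶ d.syz :=
  FLMod.ofHom (M := c.syz) (N := d.syz) <| g.restrict fun x hx => by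
    have := LinearMap.congr_fun h x
    simp only [LinearMap.comp_apply, LinearMap.mem_ker.mp hx, map_zero] at this
    exact LinearMap.mem_ker.mpr this

/-- In the stable category the map induced on kernels depends only on the class of `f`. -/
theorem syzMap_stable {M N : FLMod R} (c : ProjCover M) (d : ProjCover N) {f f' : M ⟶ N}
    (hf : stableRel R f f') (g g' : c.P.obj →ₗ[R] d.P.obj)
    (h : d.p ∘ₗ g = FLMod.lin f ∘ₗ c.p) (h' : d.p ∘ₗ g' = FLMod.lin f' ∘ₗ c.p) :
    (stableProj R).map (syzMap c d f g h) = (stableProj R).map (syzMap c d f' g' h') := by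
  obtain ⟨Q, a, b, hQ, hab⟩ := hf
  obtain ⟨b', hb'⟩ := Module.projective_lifting_property d.p (FLMod.lin b) d.surjective
  have key : ∀ x, d.p (g x) = d.p (g' x) + d.p (b' (FLMod.lin a (c.p x))) := by
    intro x
    have h1 := LinearMap.congr_fun h x
    have h2 := LinearMap.congr_fun h' x
    have h3 := LinearMap.congr_fun hb' (FLMod.lin a (c.p x))
    simp only [LinearMap.comp_apply] at h1 h2 h3
    rw [h1, h2, h3, hab]
    rfl
  let t : c.P.obj →ₗ[R] LinearMap.ker d.p :=
    LinearMap.codRestrict (LinearMap.ker d.p) (g - g' - b' ∘ₗ FLMod.lin a ∘ₗ c.p) fun x => by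
      simp [LinearMap.mem_ker, key x]
  refine CategoryTheory.Quotient.sound _ ⟨c.P,
    FLMod.ofHom (M := c.syz) (N := c.P) (LinearMap.ker c.p).subtype,
    FLMod.ofHom (M := c.P) (N := d.syz) t, c.projective, ?_⟩
  apply ObjectProperty.hom_ext
  apply ModuleCat.hom_ext
  apply LinearMap.ext
  intro x
  apply Subtype.ext
  have hx : c.p x.1 = 0 := x.2
  change g x.1 = g' x.1 + (g x.1 - g' x.1 - b' (FLMod.lin a (c.p x.1)))
  rw [hx]
  simp

end ProjCover

theorem stableRel_refl {R : Type u} [Ring R] {M N : FLMod R} (c : ProjCover M) (f : M ⟶ N) :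
    stableRel R f f :=
  ⟨c.P, 0, 0, c.projective, by simp⟩

/-- The syzygy functor on `mod R` with values in the stable category, formed with a given choice of
projective covers: it sends `M` to the kernel of its projective cover, and a morphism to
the class of the map induced on kernels by any lift of it to the projective covers. -/
def syzygyAux {R : Type u} [Ring R] (c : ∀ M : FLMod R, ProjCover M) : FLMod R ⥤ StableMod R where
  obj M := (stableProj R).obj (c M).syz
  map {M N} f := (stableProj R).map
    ((c M).syzMap (c N) f ((c M).exists_lift (c N) f).choose
      ((c M).exists_lift (c N) f).choose_spec)
  map_id M := by
    rw [← (stableProj R).map_id]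
    exact (c M).syzMap_stable (c M) (stableRel_refl (c M) (𝟙 M)) _ LinearMap.id _ rfl
  map_comp {L M N} f g := by
    rw [← (stableProj R).map_comp]
    refine (c L).syzMap_stable (c N) (stableRel_refl (c L) (f ≫ g)) _
      (((c M).exists_lift (c N) g).choose ∘ₗ ((c L).exists_lift (c M) f).choose) _ ?_
    have h1 := ((c M).exists_lift (c N) g).choose_spec
    have h2 := ((c L).exists_lift (c M) f).choose_spec
    rw [← LinearMap.comp_assoc, h1, LinearMap.comp_assoc, h2]
    rfl

/-- The syzygy functor `Ω` on the stable module category, formed with a given choice of projective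
covers. -/
def syzygy {R : Type u} [Ring R] (c : ∀ M : FLMod R, ProjCover M) : StableMod R ⥤ StableMod R :=
  CategoryTheory.Quotient.lift _ (syzygyAux c) fun M N _ _ h =>
    (c M).syzMap_stable (c N) h _ _ _ _

/-! ### The algebra `k[x]/(x^n)`, its modules and the Auslander algebra -/

/-- `Λ_n = k[x]/(x^n)`. -/
abbrev Lam (k : Type u) [Field k] (n : ℕ) : Type u :=
  Polynomial k ⧸ Ideal.span {(Polynomial.X : Polynomial k) ^ n}

/-- The class of `x` in `Λ_n`. -/
def Lam.x (k : Type u) [Field k] (n : ℕ) : Lam k n := Ideal.Quotient.mk _ Polynomial.X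

/-- The `Λ_n`-module `[i] = Λ_n/(x^i)`; for `i ≤ n` it is indecomposable of length `i`
(and zero for `i = 0`). -/
abbrev Cyc (k : Type u) [Field k] (n i : ℕ) : Type u :=
  Lam k n ⧸ Ideal.span {Lam.x k n ^ i}

/-- The minimal Auslander generator `E = [1] ⊕ ⋯ ⊕ [n]` of `Λ_n`. -/
def Gen (k : Type u) [Field k] (n : ℕ) : Type u :=
  (i : Fin n) → Cyc k n (i.val + 1)

instance (k : Type u) [Field k] (n : ℕ) : AddCommGroup (Gen k n) :=
  inferInstanceAs (AddCommGroup ((i : Fin n) → Cyc k n (i.val + 1)))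

instance (k : Type u) [Field k] (n : ℕ) : Module (Lam k n) (Gen k n) :=
  inferInstanceAs (Module (Lam k n) ((i : Fin n) → Cyc k n (i.val + 1)))

instance (k : Type u) [Field k] (n : ℕ) : Module.Finite (Lam k n) (Gen k n) :=
  inferInstanceAs (Module.Finite (Lam k n) ((i : Fin n) → Cyc k n (i.val + 1)))

instance (k : Type u) [Field k] (n : ℕ) : Module k (Gen k n) :=
  inferInstanceAs (Module k ((i : Fin n) → Cyc k n (i.val + 1)))

instance (k : Type u) [Field k] (n : ℕ) : IsScalarTower k (Lam k n) (Gen k n) :=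
  inferInstanceAs (IsScalarTower k (Lam k n) ((i : Fin n) → Cyc k n (i.val + 1)))

/-- The Auslander algebra `A_n = End(E)ᵒᵖ` of `Λ_n`. -/
abbrev Aus (k : Type u) [Field k] (n : ℕ) : Type u :=
  (Module.End (Lam k n) (Gen k n))ᵐᵒᵖ

/-- The idempotent endomorphism of `E` which projects `E` onto its direct summand `[n]`. -/
def Gen.projLast (k : Type u) [Field k] (n : ℕ) : Gen k n →ₗ[Lam k n] Gen k n where
  toFun v := fun i => if i.val + 1 = n then v i else 0
  map_add' v w := by
    funext i
    change (if _ then v i + w i else 0) = (if _ then v i else 0) + (if _ then w i else 0)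
    split_ifs <;> simp
  map_smul' r v := by
    funext i
    change (if _ then r • v i else 0) = r • (if _ then v i else 0)
    split_ifs <;> simp

/-- The idempotent `e(n)` of `A_n`, given by the projection of `E` onto `[n]`. -/
def Aus.e (k : Type u) [Field k] (n : ℕ) : Aus k n := MulOpposite.op (Gen.projLast k n)

/-- The two-sided ideal `⟨e(n)⟩` of `A_n`. -/
abbrev Aus.eIdeal (k : Type u) [Field k] (n : ℕ) : Ideal (Aus k n) :=
  (TwoSidedIdeal.span {Aus.e k n}).asIdeal

instance (k : Type u) [Field k] (n : ℕ) : Module.Finite k (Lam k n) :=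
  Polynomial.Monic.finite_quotient (Polynomial.monic_X_pow n)

instance (k : Type u) [Field k] (n : ℕ) : IsArtinianRing (Lam k n) :=
  IsArtinianRing.of_finite k (Lam k n)

/-- For `R`-modules `M` and `N`, the group `Hom(M, N)` is a left module over `End(M)ᵒᵖ`: an
endomorphism acts by precomposition. -/
instance homModule {R M N : Type*} [CommRing R] [AddCommGroup M] [Module R M] [AddCommGroup N]
    [Module R N] : Module (Module.End R M)ᵐᵒᵖ (M →ₗ[R] N) where
  smul a g := g ∘ₗ a.unop
  one_smul _ := rfl
  mul_smul _ _ _ := rfl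
  smul_zero _ := rfl
  smul_add _ _ _ := rfl
  add_smul a b g := LinearMap.comp_add a.unop b.unop g
  zero_smul g := LinearMap.comp_zero g

theorem isFiniteLength_hom (k : Type u) [Field k] (n : ℕ) (X : FLMod (Lam k n)) :
    IsFiniteLength (Aus k n) (Gen k n →ₗ[Lam k n] X.obj) := by
  have hX := isFiniteLength_iff_isNoetherian_isArtinian.mp X.property
  obtain ⟨h1, h2⟩ := hX
  have : IsNoetherian (Lam k n) (Gen k n →ₗ[Lam k n] X.obj) := inferInstance
  have : IsScalarTower (Lam k n) (Aus k n) (Gen k n →ₗ[Lam k n] X.obj) :=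
    ⟨fun r a g => by ext1 v; exact map_smul g r (a.unop v)⟩
  exact isFiniteLength_iff_isNoetherian_isArtinian.mpr
    ⟨isNoetherian_of_tower (Lam k n) inferInstance, isArtinian_of_tower (Lam k n) inferInstance⟩

/-! ### The functors `α` and `δ` -/

/-- The map `Hom(E, f) : Hom(E, X) → Hom(E, Y)` of `A_n`-modules induced by `f : X → Y`. -/
def homMap {k : Type u} [Field k] {n : ℕ} {X Y : FLMod (Lam k n)} (f : X ⟶ Y) :
    (Gen k n →ₗ[Lam k n] X.obj) →ₗ[Aus k n] (Gen k n →ₗ[Lam k n] Y.obj) where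
  toFun g := FLMod.lin f ∘ₗ g
  map_add' g h := LinearMap.comp_add g h _
  map_smul' _ _ := rfl

/-- The functor `α : mod T₂(Λ_n) → mod A_n`, where modules over the triangular matrix ring
`T₂(Λ_n)` are maps of `Λ_n`-modules: it sends `f` to the cokernel of `Hom(E, f)`. -/
def alpha (k : Type u) [Field k] (n : ℕ) : Arrow (FLMod (Lam k n)) ⥤ FLMod (Aus k n) where
  obj f := FLMod.of ((Gen k n →ₗ[Lam k n] f.right.obj) ⧸ LinearMap.range (homMap f.hom))
    (isFiniteLength_of_surjective (Submodule.mkQ _) (Submodule.mkQ_surjective _)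
      (isFiniteLength_hom k n f.right))
  map {f f'} s := FLMod.ofHom <| Submodule.mapQ _ _ (homMap s.right) <| by
    rintro _ ⟨g, rfl⟩
    refine ⟨homMap s.left g, ?_⟩
    have h := s.w
    have h2 : ∀ v, FLMod.lin f'.hom (FLMod.lin s.left v) = FLMod.lin s.right (FLMod.lin f.hom v) :=
      fun v => LinearMap.congr_fun (congrArg FLMod.lin h) v
    exact LinearMap.ext fun v => h2 (g v)
  map_id f := by
    apply ObjectProperty.hom_ext
    apply ModuleCat.hom_ext
    apply Submodule.linearMap_qext
    rfl
  map_comp s t := by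
    apply ObjectProperty.hom_ext
    apply ModuleCat.hom_ext
    apply Submodule.linearMap_qext
    rfl

/-- The map `M/IM → N/IN` of `A/I`-modules induced by a map `f : M → N` of `A`-modules. -/
def modIdealMap {A : Type u} [Ring A] (I : Ideal A) [I.IsTwoSided] {M N : Type u}
    [AddCommGroup M] [Module A M] [AddCommGroup N] [Module A N] (f : M →ₗ[A] N) :
    (M ⧸ I • (⊤ : Submodule A M)) →ₗ[A ⧸ I] (N ⧸ I • (⊤ : Submodule A N)) where
  toFun := Submodule.mapQ (I • ⊤) (I • ⊤) f (by
    rw [← Submodule.map_le_iff_le_comap, Submodule.map_smul'']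
    exact Submodule.smul_mono le_rfl le_top)
  map_add' x y := map_add _ x y
  map_smul' a x := by
    obtain ⟨a, rfl⟩ := Ideal.Quotient.mk_surjective a
    obtain ⟨x, rfl⟩ := Submodule.Quotient.mk_surjective _ x
    exact congrArg Submodule.Quotient.mk (map_smul f a x)

theorem isFiniteLength_modIdeal {A : Type u} [Ring A] (I : Ideal A) [I.IsTwoSided] {M : Type u}
    [AddCommGroup M] [Module A M] (h : IsFiniteLength A M) :
    IsFiniteLength (A ⧸ I) (M ⧸ I • (⊤ : Submodule A M)) :=
  let f : M →ₛₗ[Ideal.Quotient.mk I] (M ⧸ I • (⊤ : Submodule A M)) :=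
    { toFun := Submodule.Quotient.mk
      map_add' := fun _ _ => rfl
      map_smul' := fun _ _ => rfl }
  have : RingHomSurjective (Ideal.Quotient.mk I) := ⟨Ideal.Quotient.mk_surjective⟩
  isFiniteLength_of_surjective f (Submodule.Quotient.mk_surjective _) h

/-- For a two-sided ideal `I` of `A`, the functor `mod A → mod A/I` which sends `M` to its largest
factor module annihilated by `I`, namely `M/IM`. For `I = ⟨e⟩` this is `M/AeM`. -/
def modIdeal {A : Type u} [Ring A] (I : Ideal A) [I.IsTwoSided] : FLMod A ⥤ FLMod (A ⧸ I) where
  obj M := FLMod.of (M.obj ⧸ I • (⊤ : Submodule A M.obj)) (isFiniteLength_modIdeal I M.property)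
  map f := FLMod.ofHom (modIdealMap I (FLMod.lin f))
  map_id M := by
    apply ObjectProperty.hom_ext
    apply ModuleCat.hom_ext
    apply LinearMap.ext
    intro x
    obtain ⟨x, rfl⟩ := Submodule.Quotient.mk_surjective _ x
    rfl
  map_comp f g := by
    apply ObjectProperty.hom_ext
    apply ModuleCat.hom_ext
    apply LinearMap.ext
    intro x
    obtain ⟨x, rfl⟩ := Submodule.Quotient.mk_surjective _ x
    rfl

theorem isFiniteLength_restrictAlong {B C : Type u} [Ring B] [Ring C] (φ : C ≃+* B)
    (M : ModuleCat.{u} B) (h : IsFiniteLength B M) :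
    IsFiniteLength C ((ModuleCat.restrictScalars φ.toRingHom).obj M) :=
  have : RingHomSurjective φ.symm.toRingHom := ⟨φ.symm.surjective⟩
  let f : M →ₛₗ[φ.symm.toRingHom] (ModuleCat.restrictScalars φ.toRingHom).obj M :=
    { toFun := fun x : M => x
      map_add' := fun _ _ => rfl
      map_smul' := fun b x => by
        change b • x = φ (φ.symm b) • x
        rw [φ.apply_symm_apply] }
  isFiniteLength_of_surjective f (fun x => ⟨x, rfl⟩) h

/-- Modules over `B` regarded as modules over `C` through an isomorphism of rings `C ≃ B`. -/
def restrictAlong {B C : Type u} [Ring B] [Ring C] (φ : C ≃+* B) : FLMod B ⥤ FLMod C where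
  obj M := ⟨(ModuleCat.restrictScalars φ.toRingHom).obj M.obj,
    isFiniteLength_restrictAlong φ M.obj M.property⟩
  map f := ObjectProperty.homMk ((ModuleCat.restrictScalars φ.toRingHom).map f.hom)
  map_id _ := rfl
  map_comp _ _ := rfl

/-! ### The submodule category -/

/-- The submodule category `S(n)`: the full subcategory of the category of maps between
`Λ_n`-modules of finite length given by the monomorphisms `u : X → Y`. -/
abbrev SubCat (k : Type u) [Field k] (n : ℕ) :=
  ObjectProperty.FullSubcategory
    (fun u : Arrow (FLMod (Lam k n)) => Function.Injective (FLMod.lin u.hom))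

/-- The inclusion functor `ι : S(n) → mod T₂(Λ_n)`. -/
abbrev iota (k : Type u) [Field k] (n : ℕ) : SubCat k n ⥤ Arrow (FLMod (Lam k n)) :=
  ObjectProperty.ι _

/-- The quotient module `Y/X` of an arrow `X → Y`, that is, of `Y` by the image of the arrow. -/
def coker {R : Type u} [Ring R] (u : Arrow (FLMod R)) : FLMod R :=
  FLMod.of (u.right.obj ⧸ LinearMap.range (FLMod.lin u.hom))
    (isFiniteLength_of_surjective (Submodule.mkQ _) (Submodule.mkQ_surjective _) u.right.property)

/-- The map `Y/X → Y'/X'` induced by a morphism of arrows. -/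
def cokerMap {R : Type u} [Ring R] {u v : Arrow (FLMod R)} (s : u ⟶ v) : coker u ⟶ coker v :=
  FLMod.ofHom (M := coker u) (N := coker v) <| Submodule.mapQ _ _ (FLMod.lin s.right) <| by
    rintro _ ⟨x, rfl⟩
    exact ⟨FLMod.lin s.left x, LinearMap.congr_fun (congrArg FLMod.lin s.w) x⟩

/-- The canonical projection `Y → Y/X`. -/
def cokerProj {R : Type u} [Ring R] (u : Arrow (FLMod R)) : u.right ⟶ coker u :=
  FLMod.ofHom (N := coker u) (Submodule.mkQ _)

/-- The functor `ε : S(n) → mod T₂(Λ_n)` sending `X ⊆ Y` to the canonical projection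
`Y → Y/X`. -/
def epsilon (k : Type u) [Field k] (n : ℕ) : SubCat k n ⥤ Arrow (FLMod (Lam k n)) where
  obj u := Arrow.mk (cokerProj u.obj)
  map {_ _} s := Arrow.homMk s.hom.right (cokerMap s.hom) rfl
  map_id u := by
    apply Arrow.hom_ext
    · rfl
    · apply ObjectProperty.hom_ext
      apply ModuleCat.hom_ext
      apply Submodule.linearMap_qext
      rfl
  map_comp s t := by
    apply Arrow.hom_ext
    · rfl
    · apply ObjectProperty.hom_ext
      apply ModuleCat.hom_ext
      apply Submodule.linearMap_qext
      rfl

/-! ### Preprojective algebras -/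

/-- The generators of the preprojective algebra of a quiver with vertex set `V` and arrow set `Q`:
the trivial paths, the arrows `a` and the opposite arrows `a*`. -/
inductive PreprojGen (V Q : Type) : Type
  | vertex (v : V)
  | arrow (a : Q)
  | opp (a : Q)

/-- The defining relations of the preprojective algebra of the finite quiver with vertex set `V`,
arrow set `Q`, source map `s` and target map `t`. Paths are composed like functions. The first six
relations present the path algebra of the double quiver. -/
inductive PreprojRel (k : Type u) [Field k] {V Q : Type} [Fintype V] [Fintype Q] (s t : Q → V) :
    FreeAlgebra k (PreprojGen V Q) → FreeAlgebra k (PreprojGen V Q) → Prop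
  | idem (v : V) : PreprojRel k s t
      (FreeAlgebra.ι k (.vertex v) * FreeAlgebra.ι k (.vertex v)) (FreeAlgebra.ι k (.vertex v))
  | orth (v w : V) (h : v ≠ w) : PreprojRel k s t
      (FreeAlgebra.ι k (.vertex v) * FreeAlgebra.ι k (.vertex w)) 0
  | sum_vertex : PreprojRel k s t (∑ v : V, FreeAlgebra.ι k (.vertex v)) 1
  | arrow (a : Q) : PreprojRel k s t
      (FreeAlgebra.ι k (.vertex (t a)) * FreeAlgebra.ι k (.arrow a) *
        FreeAlgebra.ι k (.vertex (s a)))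
      (FreeAlgebra.ι k (.arrow a))
  | opp (a : Q) : PreprojRel k s t
      (FreeAlgebra.ι k (.vertex (s a)) * FreeAlgebra.ι k (.opp a) *
        FreeAlgebra.ι k (.vertex (t a)))
      (FreeAlgebra.ι k (.opp a))
  | preproj : PreprojRel k s t
      (∑ a : Q, (FreeAlgebra.ι k (.arrow a) * FreeAlgebra.ι k (.opp a) -
        FreeAlgebra.ι k (.opp a) * FreeAlgebra.ι k (.arrow a))) 0

/-- The preprojective algebra `Π_m` of type `A_m`, for the quiver `0 → 1 → ⋯ → m-1`: the `i`-th
arrow, where `i < m - 1`, goes from `i` to `i + 1`. -/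
abbrev Preproj (k : Type u) [Field k] (m : ℕ) : Type u :=
  RingQuot (PreprojRel k (V := Fin m) (Q := Fin (m - 1))
    (fun i => ⟨i.val, by omega⟩) (fun i => ⟨i.val + 1, by omega⟩))

/-! ### The functors `F` and `G` -/

section

variable (k : Type u) [Field k] (n : ℕ) (φ : Preproj k (n - 1) ≃ₐ[k] (Aus k n ⧸ Aus.eIdeal k n))

/-- The functor `δ : mod A_n → mod Π_{n-1}`, `M ↦ M/A_n e(n) M`, where `Π_{n-1}` is identified with
`A_n/⟨e(n)⟩` by means of `φ`. -/
def delta : FLMod (Aus k n) ⥤ FLMod (Preproj k (n - 1)) :=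
  modIdeal (Aus.eIdeal k n) ⋙ restrictAlong φ.toRingEquiv

/-- The functor `F = δ α ι : S(n) → mod Π_{n-1}`. -/
def functorF : SubCat k n ⥤ FLMod (Preproj k (n - 1)) :=
  iota k n ⋙ alpha k n ⋙ delta k n φ

/-- The functor `G = δ α ε : S(n) → mod Π_{n-1}`. -/
def functorG : SubCat k n ⥤ FLMod (Preproj k (n - 1)) :=
  epsilon k n ⋙ alpha k n ⋙ delta k n φ

end

end SubmodPreproj

end

/-!
Let `u : X → Y` be an object of `S(n)`, let `Z = Y/X` and let `I = ⟨e⟩`. Applying `Hom(E, -)` to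
`0 → X → Y → Z → 0` gives the exact sequence of `A_n`-modules
`0 → Cok Hom(E, X → Y) → Hom(E, Z) → Cok Hom(E, Y → Z) → 0`, natural in `u`. Its middle term is
projective, since every `Λ_n`-module of finite length is a direct summand of a power of `E`
(`projective_hom`). Its last term is annihilated by `I`, because maps from the free module `[n]`
lift along `Y → Z` (`eIdeal_le_annihilator`). As `I` is generated by an idempotent, `I² = I`, and
together these facts make reduction modulo `I` exact on the sequence (`modIdeal_exact`). So
`F(u)` is the kernel of a surjection from a projective module onto `G(u)`, naturally in `u`
(`presFG`, `covers_presFG`). As in Schanuel's lemma, the kernels of two such surjections agree in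
the stable category, through the maps that cover the identity, and these are natural
(`ProjPres.Covers.stable_eq`, `nonempty_iso_syzygy`).

For the isomorphism `Π_{n-1} ≅ A_n/I`, the algebra `A_n` has as basis the matrix units that send the
generator of `[i + 1]` to `x ^ q` in `[j + 1]`. The ones with `i + q ≥ n - 1` factor through `[n]`,
and the remaining ones are linearly independent modulo `I`, as all maps in `I` send the kernel of
`x ^ a` into `x ^ (n - a) E` (`Aus.linearIndependent_unit`). In `Π_{n-1}` the sum of all arrows
commutes with the sum of their opposites, so the algebra is spanned by the paths which consist of
opposite arrows followed by arrows (`Preproj.pathSpan_eq_top`), and these correspond bijectively to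
the remaining matrix units (`Aus.ofPreproj_path_of_le`). Finally, `Π_{n-1}` is of finite length, and
so projective covers exist by Fitting's lemma (`nonempty_projCover`).
-/

noncomputable section

namespace SubmodPreproj

/-! ### Comparison of projective presentations -/

section Presentations

variable {R : Type u} [Ring R]

/-- A short exact sequence `0 → K → P → M → 0` in `mod R` with `P` projective. No minimality is
asked for, so `K` agrees with the syzygy of `M` only up to projective summands. -/
structure ProjPres (K M : FLMod R) where
  /-- the middle term -/
  P : FLMod R
  /-- the inclusion of the kernel -/
  i : K.obj →ₗ[R] P.obj
  /-- the projection -/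
  p : P.obj →ₗ[R] M.obj
  projective : Module.Projective R P.obj
  injective : Function.Injective i
  exact : LinearMap.range i = LinearMap.ker p
  surjective : Function.Surjective p

namespace ProjPres

variable {K K' K'' M M' M'' : FLMod R}

theorem p_i (S : ProjPres K M) (x : K.obj) : S.p (S.i x) = 0 :=
  LinearMap.mem_ker.mp (S.exact ▸ LinearMap.mem_range_self S.i x)

/-- `κ : K → K'` covers `f : M → M'` if both extend to a map between the two presentations. -/
def Covers (S : ProjPres K M) (T : ProjPres K' M') (f : M ⟶ M') (κ : K ⟶ K') : Prop :=
  ∃ g : S.P.obj →ₗ[R] T.P.obj, T.p ∘ₗ g = FLMod.lin f ∘ₗ S.p ∧ T.i ∘ₗ FLMod.lin κ = g ∘ₗ S.i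

/-- A linear map into `P` that vanishes in `M` factors through the kernel `K`. -/
theorem exists_factor (S : ProjPres K M) {N : Type*} [AddCommGroup N] [Module R N]
    (h : N →ₗ[R] S.P.obj) (hh : ∀ x, S.p (h x) = 0) : ∃ t : N →ₗ[R] K.obj, S.i ∘ₗ t = h := by
  let e := LinearEquiv.ofInjective S.i S.injective
  refine ⟨e.symm.toLinearMap ∘ₗ h.codRestrict (LinearMap.range S.i) fun x => ?_, ?_⟩
  · rw [S.exact]
    exact LinearMap.mem_ker.mpr (hh x)
  · ext x
    exact congrArg Subtype.val (e.apply_symm_apply _)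

theorem exists_covers (S : ProjPres K M) (T : ProjPres K' M') (f : M ⟶ M') :
    ∃ κ : K ⟶ K', Covers S T f κ := by
  have := S.projective
  obtain ⟨g, hg⟩ := Module.projective_lifting_property T.p (FLMod.lin f ∘ₗ S.p) T.surjective
  obtain ⟨t, ht⟩ := T.exists_factor (g ∘ₗ S.i) fun x => by
    have := LinearMap.congr_fun hg (S.i x)
    simp only [LinearMap.comp_apply, S.p_i, map_zero] at this
    exact this
  exact ⟨FLMod.ofHom t, g, hg, ht⟩

theorem Covers.id (S : ProjPres K M) : Covers S S (𝟙 M) (𝟙 K) :=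
  ⟨LinearMap.id, rfl, rfl⟩

theorem Covers.comp {S : ProjPres K M} {T : ProjPres K' M'} {U : ProjPres K'' M''} {f : M ⟶ M'}
    {f' : M' ⟶ M''} {κ : K ⟶ K'} {κ' : K' ⟶ K''} (h : Covers S T f κ) (h' : Covers T U f' κ') :
    Covers S U (f ≫ f') (κ ≫ κ') := by
  obtain ⟨g, h1, h2⟩ := h
  obtain ⟨g', h1', h2'⟩ := h'
  refine ⟨g' ∘ₗ g, ?_, ?_⟩
  · rw [← LinearMap.comp_assoc, h1', LinearMap.comp_assoc, h1]
    rfl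
  · rw [LinearMap.comp_assoc, ← h2, ← LinearMap.comp_assoc, ← h2']
    rfl

/-- Two maps covering the same map agree in the stable category: their difference is induced by
the difference of the two lifts, which maps `P` into `K'`, and so it factors through `P`. -/
theorem Covers.stable_eq {S : ProjPres K M} {T : ProjPres K' M'} {f : M ⟶ M'} {κ κ' : K ⟶ K'}
    (h : Covers S T f κ) (h' : Covers S T f κ') :
    (stableProj R).map κ = (stableProj R).map κ' := by
  obtain ⟨g, h1, h2⟩ := h
  obtain ⟨g', h1', h2'⟩ := h'
  obtain ⟨t, ht⟩ := T.exists_factor (g - g') fun x => by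
    have e1 := LinearMap.congr_fun h1 x
    have e2 := LinearMap.congr_fun h1' x
    simp only [LinearMap.comp_apply] at e1 e2
    rw [LinearMap.sub_apply, map_sub, e1, e2, sub_self]
  refine CategoryTheory.Quotient.sound _ ⟨S.P, FLMod.ofHom S.i, FLMod.ofHom t, S.projective, ?_⟩
  apply ObjectProperty.hom_ext
  apply ModuleCat.hom_ext
  apply LinearMap.ext
  intro x
  apply T.injective
  have e1 := LinearMap.congr_fun h2 x
  have e2 := LinearMap.congr_fun h2' x
  have e3 := LinearMap.congr_fun ht (S.i x)
  simp only [LinearMap.comp_apply, LinearMap.sub_apply] at e1 e2 e3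
  change T.i (FLMod.lin κ x) = T.i (FLMod.lin κ' x + t (S.i x))
  rw [map_add, e1, e2, e3, add_sub_cancel]

end ProjPres

/-- The presentation given by a projective cover. -/
def ProjCover.pres {M : FLMod R} (c : ProjCover M) : ProjPres c.syz M where
  P := c.P
  i := (LinearMap.ker c.p).subtype
  p := c.p
  projective := c.projective
  injective := Subtype.val_injective
  exact := Submodule.range_subtype _
  surjective := c.surjective

theorem ProjCover.covers_syzMap {M N : FLMod R} (c : ProjCover M) (d : ProjCover N) (f : M ⟶ N)
    (g : c.P.obj →ₗ[R] d.P.obj) (h : d.p ∘ₗ g = FLMod.lin f ∘ₗ c.p) :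
    ProjPres.Covers c.pres d.pres f (c.syzMap d f g h) :=
  ⟨g, h, rfl⟩

/-- If the values of `F` and `G` are the end terms of projective presentations, and `F` maps
morphisms to maps covering their images under `G`, then `F` is stably the syzygy of `G`. -/
theorem nonempty_iso_syzygy {C : Type*} [Category C] (F G : C ⥤ FLMod R)
    (S : ∀ X, ProjPres (F.obj X) (G.obj X))
    (hS : ∀ {X Y : C} (s : X ⟶ Y), ProjPres.Covers (S X) (S Y) (G.map s) (F.map s))
    (c : ∀ M : FLMod R, ProjCover M) :
    Nonempty (F ⋙ stableProj R ≅ G ⋙ stableProj R ⋙ syzygy c) := by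
  choose a ha using fun X => (S X).exists_covers (c (G.obj X)).pres (𝟙 _)
  choose b hb using fun X => (c (G.obj X)).pres.exists_covers (S X) (𝟙 _)
  refine ⟨NatIso.ofComponents (fun X =>
    { hom := (stableProj R).map (a X)
      inv := (stableProj R).map (b X)
      hom_inv_id := ?_
      inv_hom_id := ?_ }) ?_⟩
  · refine ((stableProj R).map_comp (a X) (b X)).symm.trans
      ((((ha X).comp (hb X)).stable_eq ?_).trans ((stableProj R).map_id _))
    rw [Category.comp_id]
    exact .id _
  · refine ((stableProj R).map_comp (b X) (a X)).symm.trans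
      ((((hb X).comp (ha X)).stable_eq ?_).trans ((stableProj R).map_id _))
    rw [Category.comp_id]
    exact .id _
  · intro X Y s
    have h1 := (hS s).comp (ha Y)
    have h2 := (ha X).comp ((c (G.obj X)).covers_syzMap (c (G.obj Y)) (G.map s) _
      ((c (G.obj X)).exists_lift (c (G.obj Y)) (G.map s)).choose_spec)
    rw [Category.comp_id] at h1
    rw [Category.id_comp] at h2
    have h3 := h1.stable_eq h2
    rw [Functor.map_comp, Functor.map_comp] at h3
    exact h3

end Presentations

/-! ### Existence of projective covers -/

/-- Over a ring of finite length every module of finite length has a projective cover. A submodule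
of a free module which is minimal among the projective ones that still map onto `M` does it: if
`N` also maps onto `M`, an endomorphism over `M` with image in `N` has, by Fitting's lemma, a power
whose image is a direct summand, and minimality makes this image everything. -/
theorem nonempty_projCover {R : Type u} [Ring R] (hR : IsFiniteLength R R) (M : FLMod R) :
    Nonempty (ProjCover M) := by
  obtain ⟨_, _⟩ := isFiniteLength_iff_isNoetherian_isArtinian.mp hR
  obtain ⟨_, _⟩ := isFiniteLength_iff_isNoetherian_isArtinian.mp M.property
  obtain ⟨m, π, hπ⟩ := Module.Finite.exists_fin' R M.obj
  let s : Set (Submodule R (Fin m → R)) :=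
    {P | Module.Projective R P ∧ Function.Surjective (π ∘ₗ P.subtype)}
  have hs : s.Nonempty := ⟨⊤, Module.Projective.of_equiv (Submodule.topEquiv (R := R)).symm,
    fun x => (hπ x).imp' (fun y => ⟨y, trivial⟩) fun _ h => h⟩
  obtain ⟨P, ⟨hP, hsurj⟩, hmin⟩ := exists_minimal_of_wellFoundedLT (· ∈ s) hs
  refine ⟨⟨FLMod.of P (isFiniteLength_iff_isNoetherian_isArtinian.mpr ⟨inferInstance,
    inferInstance⟩), π ∘ₗ P.subtype, hP, hsurj, fun N hN => ?_⟩⟩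
  change Submodule R P at N
  set p : P →ₗ[R] M.obj := π ∘ₗ P.subtype with hp
  have hNs : Function.Surjective (p ∘ₗ N.subtype) := by
    intro x
    obtain ⟨y, rfl⟩ := hsurj x
    have hy : y ∈ N ⊔ LinearMap.ker p := hN ▸ Submodule.mem_top
    obtain ⟨a, ha, b, hb, rfl⟩ := Submodule.mem_sup.mp hy
    refine ⟨⟨a, ha⟩, ?_⟩
    rw [map_add, LinearMap.mem_ker.mp hb, add_zero]
    rfl
  obtain ⟨h, hh⟩ := Module.projective_lifting_property (p ∘ₗ N.subtype) p hNs
  let f : Module.End R P := N.subtype ∘ₗ h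
  have hf : ∀ (r : ℕ) (x : P), p ((f ^ r) x) = p x := by
    intro r
    induction r with
    | zero => intro x; rfl
    | succ r ih =>
      intro x
      rw [pow_succ, Module.End.mul_apply, ih]
      exact LinearMap.congr_fun hh x
  obtain ⟨r, hr⟩ := Filter.eventually_atTop.mp f.eventually_isCompl_ker_pow_range_pow
  have hc := hr (r + 1) (Nat.le_succ r)
  set I := LinearMap.range (f ^ (r + 1)) with hI
  have hIproj : Module.Projective R I := by
    refine Module.Projective.of_split I.subtype (Submodule.projectionOnto I _ hc.symm) ?_
    ext x
    simp
  have hmem : I.map P.subtype ∈ s := by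
    refine ⟨Module.Projective.of_equiv (Submodule.equivMapOfInjective P.subtype
      P.injective_subtype I), fun x => ?_⟩
    obtain ⟨y, rfl⟩ := hsurj x
    exact ⟨⟨_, Submodule.mem_map_of_mem (LinearMap.mem_range_self (f ^ (r + 1)) y)⟩,
      hf (r + 1) y⟩
  have hle := hmin hmem (Submodule.map_subtype_le P I)
  rw [eq_top_iff]
  intro x _
  obtain ⟨y, ⟨z, rfl⟩, hy⟩ := hle x.2
  have : x = (f ^ (r + 1)) z := Subtype.ext hy.symm
  rw [this, pow_succ', Module.End.mul_apply]
  exact (h _).2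

/-! ### Reduction modulo an idempotent ideal -/

section ModIdeal

variable {A : Type u} [Ring A] (I : Ideal A) [I.IsTwoSided]

theorem projective_modIdeal {P : Type u} [AddCommGroup P] [Module A P] [Module.Projective A P] :
    Module.Projective (A ⧸ I) (P ⧸ I • (⊤ : Submodule A P)) := by
  obtain ⟨s, hs⟩ := Module.projective_def'.mp ‹Module.Projective A P›
  let t₀ : P →ₗ[A] (P →₀ A ⧸ I) := Finsupp.mapRange.linearMap I.mkQ ∘ₗ s
  let t₁ : (P ⧸ I • (⊤ : Submodule A P)) →ₗ[A] (P →₀ A ⧸ I) :=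
    (I • (⊤ : Submodule A P)).liftQ t₀ <| by
      rw [Submodule.smul_le]
      intro a ha x _
      rw [LinearMap.mem_ker, map_smul]
      ext y
      obtain ⟨b, hb⟩ := Ideal.Quotient.mk_surjective (t₀ x y)
      rw [Finsupp.smul_apply, ← hb]
      exact Ideal.Quotient.eq_zero_iff_mem.mpr (I.mul_mem_right b ha)
  let t : (P ⧸ I • (⊤ : Submodule A P)) →ₗ[A ⧸ I] (P →₀ A ⧸ I) :=
    { t₁ with
      map_smul' := fun a x => by
        obtain ⟨a, rfl⟩ := Ideal.Quotient.mk_surjective a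
        exact map_smul t₁ a x }
  let q : P → P ⧸ I • (⊤ : Submodule A P) := Submodule.Quotient.mk
  refine Module.Projective.of_split t (Finsupp.linearCombination (A ⧸ I) q)
    (LinearMap.ext fun x => ?_)
  obtain ⟨x, rfl⟩ := Submodule.Quotient.mk_surjective _ x
  change Finsupp.linearCombination (A ⧸ I) q (Finsupp.mapRange I.mkQ (map_zero _) (s x)) =
    Submodule.Quotient.mk x
  rw [Finsupp.linearCombination_apply, Finsupp.sum_mapRange_index (by simp)]
  conv_rhs => rw [← LinearMap.id_apply (R := A) x, ← hs, LinearMap.comp_apply,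
    Finsupp.linearCombination_apply, ← Submodule.mkQ_apply, map_finsuppSum]
  rfl

theorem span_asIdeal_le {e : A} {J : Ideal A} [J.IsTwoSided] (he : e ∈ J) :
    (TwoSidedIdeal.span {e}).asIdeal ≤ J := fun x hx => by
  have : TwoSidedIdeal.span {e} ≤ J.toTwoSided := by
    rw [TwoSidedIdeal.span_le, Set.singleton_subset_iff]
    exact Ideal.mem_toTwoSided.mpr he
  exact Ideal.mem_toTwoSided.mp (this hx)

/-- An ideal generated by an idempotent is idempotent. -/
theorem span_le_mul_self {e : A} (he : e * e = e) :
    (TwoSidedIdeal.span {e}).asIdeal ≤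
      (TwoSidedIdeal.span {e}).asIdeal * (TwoSidedIdeal.span {e}).asIdeal := by
  refine span_asIdeal_le ?_
  have h : e ∈ (TwoSidedIdeal.span {e}).asIdeal := TwoSidedIdeal.subset_span rfl
  have h2 := Ideal.mul_mem_mul h h
  rwa [he] at h2

/-- Reduction modulo an idempotent ideal `I` preserves short exact sequences `0 → K → P → M → 0`
with `I M = 0`, because then `I P = I² P ⊆ I K`. This is the vanishing of `Tor₁(A/I, M)`. -/
theorem modIdeal_exact (hI : I ≤ I * I) {K P M : Type u} [AddCommGroup K] [Module A K]
    [AddCommGroup P] [Module A P] [AddCommGroup M] [Module A M] (i : K →ₗ[A] P) (p : P →ₗ[A] M)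
    (hi : Function.Injective i) (hip : LinearMap.range i = LinearMap.ker p)
    (hM : I ≤ Module.annihilator A M) :
    Function.Injective (modIdealMap I i) ∧
      LinearMap.range (modIdealMap I i) = LinearMap.ker (modIdealMap I p) := by
  have h1 : I • (⊤ : Submodule A P) ≤ LinearMap.range i := by
    rw [Submodule.smul_le]
    intro a ha x _
    rw [hip, LinearMap.mem_ker, map_smul]
    exact Module.mem_annihilator.mp (hM ha) _
  have h2 : I • (⊤ : Submodule A P) ≤ (I • (⊤ : Submodule A K)).map i := by
    rw [Submodule.map_smul'', Submodule.map_top]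
    calc I • (⊤ : Submodule A P) ≤ (I * I) • ⊤ := Submodule.smul_mono_left hI
      _ = I • I • ⊤ := Submodule.mul_smul I I ⊤
      _ ≤ I • LinearMap.range i := Submodule.smul_mono le_rfl h1
  have hM' : I • (⊤ : Submodule A M) ≤ ⊥ := by
    rw [Submodule.smul_le]
    exact fun a ha x _ => Module.mem_annihilator.mp (hM ha) x
  constructor
  · rw [injective_iff_map_eq_zero]
    intro x hx
    obtain ⟨x, rfl⟩ := Submodule.Quotient.mk_surjective _ x
    obtain ⟨y, hy, hyx⟩ := h2 ((Submodule.Quotient.mk_eq_zero _).mp hx)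
    exact (Submodule.Quotient.mk_eq_zero _).mpr (hi hyx ▸ hy)
  · ext x
    obtain ⟨x, rfl⟩ := Submodule.Quotient.mk_surjective _ x
    constructor
    · rintro ⟨y, hy⟩
      obtain ⟨y, rfl⟩ := Submodule.Quotient.mk_surjective _ y
      rw [← hy, LinearMap.mem_ker]
      have : p (i y) = 0 := LinearMap.mem_ker.mp (hip ▸ LinearMap.mem_range_self i y)
      exact congrArg Submodule.Quotient.mk this
    · intro hx
      have hx' : p x = 0 := hM' ((Submodule.Quotient.mk_eq_zero _).mp hx)
      obtain ⟨y, rfl⟩ : x ∈ LinearMap.range i := hip ▸ LinearMap.mem_ker.mpr hx'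
      exact ⟨Submodule.Quotient.mk y, rfl⟩

theorem modIdealMap_surjective {P M : Type u} [AddCommGroup P] [Module A P] [AddCommGroup M]
    [Module A M] (p : P →ₗ[A] M) (hp : Function.Surjective p) :
    Function.Surjective (modIdealMap I p) := by
  intro x
  obtain ⟨x, rfl⟩ := Submodule.Quotient.mk_surjective _ x
  obtain ⟨y, rfl⟩ := hp x
  exact ⟨Submodule.Quotient.mk y, rfl⟩

end ModIdeal

/-! ### Maps between the modules `[i]` -/

open Polynomial in
/-- The projection `k[x] → [i]`. -/
def Cyc.mk (k : Type u) [Field k] (n i : ℕ) : k[X] →ₐ[k] Cyc k n i :=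
  (Ideal.Quotient.mkₐ k _).comp (Ideal.Quotient.mkₐ k _)

section Cyc

variable {k : Type u} [Field k] {n : ℕ}

open Polynomial

theorem Cyc.mk_surjective (i : ℕ) : Function.Surjective (Cyc.mk k n i) :=
  Ideal.Quotient.mk_surjective.comp Ideal.Quotient.mk_surjective

theorem Cyc.smul_mk (i : ℕ) (p g : k[X]) :
    (Ideal.Quotient.mk _ p : Lam k n) • Cyc.mk k n i g = Cyc.mk k n i (p * g) := rfl

theorem Cyc.x_pow_smul_mk (i a : ℕ) (g : k[X]) :
    Lam.x k n ^ a • Cyc.mk k n i g = Cyc.mk k n i (X ^ a * g) := by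
  rw [← Cyc.smul_mk, map_pow]
  rfl

theorem Cyc.mk_eq_zero_of_dvd {i : ℕ} {g : k[X]} (h : X ^ i ∣ g) : Cyc.mk k n i g = 0 := by
  refine Ideal.Quotient.eq_zero_iff_mem.mpr (Ideal.mem_span_singleton.mpr ?_)
  have := map_dvd (Ideal.Quotient.mk (Ideal.span {(X : k[X]) ^ n})) h
  rwa [map_pow] at this

theorem Cyc.mk_eq_zero_iff {i : ℕ} (hi : i ≤ n) {g : k[X]} : Cyc.mk k n i g = 0 ↔ X ^ i ∣ g := by
  refine ⟨fun h => ?_, Cyc.mk_eq_zero_of_dvd⟩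
  obtain ⟨c, hc⟩ := Ideal.mem_span_singleton.mp (Ideal.Quotient.eq_zero_iff_mem.mp h)
  obtain ⟨c, rfl⟩ := Ideal.Quotient.mk_surjective c
  have h1 : (Ideal.Quotient.mk (Ideal.span {(X : k[X]) ^ n})) (g - X ^ i * c) = 0 := by
    rw [map_sub, map_mul, map_pow]
    exact sub_eq_zero.mpr hc
  have h2 := Ideal.mem_span_singleton.mp (Ideal.Quotient.eq_zero_iff_mem.mp h1)
  have h3 := dvd_add ((pow_dvd_pow X hi).trans h2) (Dvd.intro c rfl : X ^ i ∣ X ^ i * c)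
  rwa [sub_add_cancel] at h3

/-- The map `[a] → M` sending `1` to an element annihilated by `x ^ a`. -/
def Cyc.lift {M : Type*} [AddCommGroup M] [Module (Lam k n) M] (a : ℕ) (m : M)
    (hm : Lam.x k n ^ a • m = 0) : Cyc k n a →ₗ[Lam k n] M :=
  Submodule.liftQ _ (LinearMap.toSpanSingleton (Lam k n) M m) <| by
    exact (Submodule.span_singleton_le_iff_mem _ _).mpr hm

theorem Cyc.lift_mk {M : Type*} [AddCommGroup M] [Module (Lam k n) M] (a : ℕ) (m : M)
    (hm : Lam.x k n ^ a • m = 0) (g : k[X]) :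
    Cyc.lift a m hm (Cyc.mk k n a g) = (Ideal.Quotient.mk _ g : Lam k n) • m := rfl

theorem Cyc.linearMap_ext {M : Type*} [AddCommGroup M] [Module (Lam k n) M] {a : ℕ}
    {f g : Cyc k n a →ₗ[Lam k n] M} (h : f (Cyc.mk k n a 1) = g (Cyc.mk k n a 1)) : f = g := by
  refine LinearMap.ext fun x => ?_
  obtain ⟨p, rfl⟩ := Cyc.mk_surjective a x
  have := Cyc.smul_mk (k := k) (n := n) a p 1
  rw [mul_one] at this
  rw [← this, map_smul, map_smul, h]

theorem Lam.x_pow_eq_zero : Lam.x k n ^ n = 0 := by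
  rw [Lam.x, ← map_pow]
  exact Ideal.Quotient.eq_zero_iff_mem.mpr (Ideal.mem_span_singleton_self _)

/-- The inclusion of the `i`-th summand of `E`. -/
def Gen.single (i : Fin n) : Cyc k n (i.val + 1) →ₗ[Lam k n] Gen k n :=
  LinearMap.single (Lam k n) (fun i : Fin n => Cyc k n (i.val + 1)) i

/-- The projection onto the `i`-th summand of `E`. -/
def Gen.proj (i : Fin n) : Gen k n →ₗ[Lam k n] Cyc k n (i.val + 1) :=
  LinearMap.proj (φ := fun i : Fin n => Cyc k n (i.val + 1)) i

theorem Gen.proj_single_same (i : Fin n) (v : Cyc k n (i.val + 1)) :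
    Gen.proj i (Gen.single i v) = v :=
  Pi.single_eq_same (M := fun i : Fin n => Cyc k n (i.val + 1)) i v

theorem Gen.proj_single_of_ne {i j : Fin n} (h : j ≠ i) (v : Cyc k n (i.val + 1)) :
    Gen.proj j (Gen.single i v) = 0 :=
  Pi.single_eq_of_ne (M := fun i : Fin n => Cyc k n (i.val + 1)) h v

theorem Gen.sum_single_proj (v : Gen k n) : ∑ i, Gen.single i (Gen.proj i v) = v :=
  Finset.univ_sum_single (M := fun i : Fin n => Cyc k n (i.val + 1)) v

theorem Gen.ext_proj {v w : Gen k n} (h : ∀ i, Gen.proj i v = Gen.proj i w) : v = w := funext h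

theorem Gen.projLast_eq (l : Fin n) (hl : l.val + 1 = n) :
    Gen.projLast k n = Gen.single l ∘ₗ Gen.proj l := by
  refine LinearMap.ext fun v => Gen.ext_proj fun i => ?_
  change (if i.val + 1 = n then v i else 0) = _
  by_cases hi : i = l
  · subst hi
    rw [if_pos hl]
    exact (Gen.proj_single_same _ _).symm
  · rw [if_neg fun h => hi (Fin.ext (by omega))]
    exact (Gen.proj_single_of_ne hi _).symm

/-- Each `[j]` with `j ≤ n`, including `[0] = 0`, is a retract of `E`. -/
theorem Cyc.exists_retract {j : ℕ} (hj : j ≤ n) :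
    ∃ (a : Cyc k n j →ₗ[Lam k n] Gen k n) (b : Gen k n →ₗ[Lam k n] Cyc k n j),
      b ∘ₗ a = LinearMap.id := by
  cases j with
  | zero =>
    refine ⟨0, 0, Cyc.linearMap_ext ?_⟩
    exact (Cyc.mk_eq_zero_of_dvd (by simp)).symm
  | succ i =>
    exact ⟨Gen.single ⟨i, hj⟩, Gen.proj ⟨i, hj⟩, 
      LinearMap.ext fun v => Gen.proj_single_same ⟨i, hj⟩ v⟩

/-! ### Projectivity of `Hom(E, Z)` -/

/-- The structure theorem for modules over the principal ideal domain `k[x]`, read for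
`Λ_n`-modules: the identity of `Z` is a sum of maps factoring through modules `[j]`, `j ≤ n`. -/
theorem exists_cyc_decomposition (Z : Type u) [AddCommGroup Z] [Module (Lam k n) Z]
    [Module.Finite (Lam k n) Z] :
    ∃ (d : ℕ) (κ : Fin d → ℕ) (ρ : ∀ i, Z →ₗ[Lam k n] Cyc k n (κ i))
      (σ : ∀ i, Cyc k n (κ i) →ₗ[Lam k n] Z),
      (∀ i, κ i ≤ n) ∧ ∀ z, ∑ i, σ i (ρ i z) = z := by
  let _ : Module k[X] Z := Module.compHom Z (Ideal.Quotient.mk (Ideal.span {(X : k[X]) ^ n}))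
  have : IsScalarTower k[X] (Lam k n) Z := ⟨fun a b z => mul_smul (Ideal.Quotient.mk _ a) b z⟩
  have : Module.Finite k[X] Z := Module.Finite.trans (Lam k n) Z
  have hX : ∀ z : Z, (X : k[X]) ^ n • z = 0 := fun z => by
    change (Ideal.Quotient.mk (Ideal.span {(X : k[X]) ^ n}) (X ^ n)) • z = 0
    have h0 := Ideal.Quotient.eq_zero_iff_mem.mpr (Ideal.mem_span_singleton_self ((X : k[X]) ^ n))
    exact (congrArg (· • z) h0).trans (zero_smul (Lam k n) z)
  obtain ⟨d, κ, ⟨Ψ⟩⟩ := Module.torsion_by_prime_power_decomposition (R := k[X]) (M := Z)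
    (p := X) prime_X.irreducible fun {z} => ⟨⟨X ^ n, n, rfl⟩, hX z⟩
  -- `z i` generates the `i`-th summand.
  let z : Fin d → Z := fun i =>
    Ψ.symm (DirectSum.lof k[X] (Fin d) (fun i => k[X] ⧸ k[X] ∙ (X : k[X]) ^ κ i) i
      (Submodule.Quotient.mk 1))
  have hz : ∀ i (g : k[X]), g • z i = Ψ.symm (DirectSum.lof k[X] (Fin d)
      (fun i => k[X] ⧸ k[X] ∙ (X : k[X]) ^ κ i) i (Submodule.Quotient.mk g)) := fun i g => by
    rw [← map_smul, ← map_smul, ← Submodule.Quotient.mk_smul, smul_eq_mul, mul_one]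
  have hz0 : ∀ i, Lam.x k n ^ κ i • z i = 0 := fun i => by
    have h := hz i (X ^ κ i)
    rw [(Submodule.Quotient.mk_eq_zero _).mpr (Submodule.mem_span_singleton_self _), map_zero,
      map_zero] at h
    have h' : Lam.x k n ^ κ i = Ideal.Quotient.mk _ (X ^ κ i) := (map_pow _ _ _).symm
    rw [h']
    exact h
  have hκ : ∀ i, κ i ≤ n := fun i => by
    have h := hz i (X ^ n)
    rw [hX, eq_comm, LinearEquiv.map_eq_zero_iff, ← map_zero (DirectSum.lof k[X] (Fin d)
      (fun i => k[X] ⧸ k[X] ∙ (X : k[X]) ^ κ i) i)] at h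
    have h2 := DirectSum.of_injective (β := fun i => k[X] ⧸ k[X] ∙ (X : k[X]) ^ κ i) i h
    obtain ⟨c, hc⟩ := Submodule.mem_span_singleton.mp ((Submodule.Quotient.mk_eq_zero _).mp h2)
    exact (pow_dvd_pow_iff X_ne_zero (not_isUnit_X)).mp ⟨c, by rw [← hc, smul_eq_mul, mul_comm]⟩
  -- `k[x]/(x^κ)` and `[κ]` are identified through their generators.
  let τ : ∀ i, (k[X] ⧸ k[X] ∙ (X : k[X]) ^ κ i) →ₗ[k[X]] Cyc k n (κ i) := fun i =>
    Submodule.liftQ _ (LinearMap.toSpanSingleton k[X] _ (Cyc.mk k n (κ i) 1)) <|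
      (Submodule.span_singleton_le_iff_mem _ _).mpr <| by
        rw [LinearMap.mem_ker, LinearMap.toSpanSingleton_apply]
        exact Cyc.mk_eq_zero_of_dvd (mul_one (X ^ κ i : k[X])).symm.dvd
  have hτ : ∀ i g, τ i (Submodule.Quotient.mk g) = Cyc.mk k n (κ i) g := fun i g =>
    congrArg (Cyc.mk k n (κ i)) (mul_one g)
  refine ⟨d, κ, fun i => (τ i ∘ₗ DirectSum.component k[X] (Fin d) _ i ∘ₗ
    Ψ.toLinearMap).extendScalarsOfSurjective (S := Lam k n) Ideal.Quotient.mk_surjective,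
    fun i => Cyc.lift (κ i) (z i) (hz0 i), hκ, fun w => ?_⟩
  obtain ⟨w, rfl⟩ := Ψ.symm.surjective w
  conv_rhs => rw [← DirectSum.sum_univ_of w, map_sum]
  refine Finset.sum_congr rfl fun i _ => ?_
  obtain ⟨g, hg⟩ := Submodule.Quotient.mk_surjective _ (w i)
  have h1 : τ i (DirectSum.component k[X] (Fin d) _ i (Ψ (Ψ.symm w))) = Cyc.mk k n (κ i) g := by
    rw [LinearEquiv.apply_symm_apply, ← hτ, hg]
    rfl
  refine (congrArg (Cyc.lift (κ i) (z i) (hz0 i)) h1).trans ?_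
  rw [Cyc.lift_mk, ← hg]
  exact hz i g

/-- The identity of `Z` is a finite sum of maps factoring through `E`. -/
theorem exists_gen_decomposition (Z : Type u) [AddCommGroup Z] [Module (Lam k n) Z]
    [Module.Finite (Lam k n) Z] :
    ∃ (d : ℕ) (r : Fin d → Z →ₗ[Lam k n] Gen k n) (s : Fin d → Gen k n →ₗ[Lam k n] Z),
      ∀ z, ∑ i, s i (r i z) = z := by
  obtain ⟨d, κ, ρ, σ, hκ, h⟩ := exists_cyc_decomposition (k := k) (n := n) Z
  choose a b hab using fun i => Cyc.exists_retract (k := k) (hκ i)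
  refine ⟨d, fun i => a i ∘ₗ ρ i, fun i => σ i ∘ₗ b i, fun z => ?_⟩
  rw [← h z]
  refine Finset.sum_congr rfl fun i _ => ?_
  rw [h z]
  exact congrArg (σ i) (LinearMap.congr_fun (hab i) (ρ i z))

theorem projective_hom (Z : Type u) [AddCommGroup Z] [Module (Lam k n) Z]
    [Module.Finite (Lam k n) Z] : Module.Projective (Aus k n) (Gen k n →ₗ[Lam k n] Z) := by
  obtain ⟨d, r, s, h⟩ := exists_gen_decomposition (k := k) (n := n) Z
  let f : (Gen k n →ₗ[Lam k n] Z) →ₗ[Aus k n] (Fin d → Aus k n) :=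
    { toFun := fun g i => MulOpposite.op (r i ∘ₗ g)
      map_add' := fun g g' => by
        funext i
        exact congrArg MulOpposite.op (LinearMap.comp_add g g' (r i))
      map_smul' := fun _ _ => rfl }
  let g : (Fin d → Aus k n) →ₗ[Aus k n] (Gen k n →ₗ[Lam k n] Z) :=
    ∑ i, LinearMap.toSpanSingleton (Aus k n) _ (s i) ∘ₗ LinearMap.proj i
  refine Module.Projective.of_split f g (LinearMap.ext fun φ => LinearMap.ext fun v => ?_)
  rw [LinearMap.comp_apply, LinearMap.sum_apply, LinearMap.sum_apply]
  exact h (φ v)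

end Cyc

/-! ### The exact sequence relating `F` and `G` -/

section Sequence

variable {k : Type u} [Field k] {n : ℕ}

open Polynomial

theorem Aus.e_mul_e : Aus.e k n * Aus.e k n = Aus.e k n := by
  refine MulOpposite.unop_injective (LinearMap.ext fun v => funext fun i => ?_)
  change (if _ then (if _ then v i else 0) else 0) = (if _ then v i else 0)
  split_ifs <;> rfl

/-- As `[n] = Λ_n` is free, maps from `[n]` lift along surjections. -/
theorem exists_lift_projLast (hn : 1 ≤ n) {Y Z : Type u} [AddCommGroup Y] [Module (Lam k n) Y]
    [AddCommGroup Z] [Module (Lam k n) Z] (q : Y →ₗ[Lam k n] Z) (hq : Function.Surjective q)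
    (g : Gen k n →ₗ[Lam k n] Z) :
    ∃ h : Gen k n →ₗ[Lam k n] Y, q ∘ₗ h = g ∘ₗ Gen.projLast k n := by
  let l : Fin n := ⟨n - 1, by omega⟩
  obtain ⟨y, hy⟩ := hq (g (Gen.single l (Cyc.mk k n _ 1)))
  have hl : l.val + 1 = n := Nat.sub_add_cancel hn
  have h0 : Lam.x k n ^ (l.val + 1) • y = 0 := by
    rw [hl, Lam.x_pow_eq_zero]
    exact zero_smul (Lam k n) y
  refine ⟨Cyc.lift (l.val + 1) y h0 ∘ₗ Gen.proj l, ?_⟩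
  have h2 : q ∘ₗ Cyc.lift (l.val + 1) y h0 = g ∘ₗ Gen.single l := by
    apply Cyc.linearMap_ext
    rw [LinearMap.comp_apply, Cyc.lift_mk, map_one, one_smul, hy]
    rfl
  rw [Gen.projLast_eq l hl, ← LinearMap.comp_assoc, h2, LinearMap.comp_assoc]

theorem eIdeal_le_annihilator (hn : 1 ≤ n) (f : Arrow (FLMod (Lam k n)))
    (hf : Function.Surjective (FLMod.lin f.hom)) :
    Aus.eIdeal k n ≤ Module.annihilator (Aus k n) ((alpha k n).obj f).obj := by
  refine span_asIdeal_le (Module.mem_annihilator.mpr fun x => ?_)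
  obtain ⟨g, rfl⟩ := Submodule.Quotient.mk_surjective _ x
  obtain ⟨h, hh⟩ := exists_lift_projLast hn (FLMod.lin f.hom) hf g
  exact (Submodule.Quotient.mk_eq_zero _).mpr ⟨h, hh⟩

theorem projective_restrictAlong {B C : Type u} [Ring B] [Ring C] (φ : C ≃+* B) (M : FLMod B)
    (h : Module.Projective B M.obj) : Module.Projective C ((restrictAlong φ).obj M).obj := by
  have : RingHomInvPair (φ.symm : B →+* C) (φ : C →+* B) :=
    ⟨RingHom.ext φ.apply_symm_apply, RingHom.ext φ.symm_apply_apply⟩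
  have : RingHomInvPair (φ : C →+* B) (φ.symm : B →+* C) := RingHomInvPair.symm _ _
  let e : M.obj ≃ₛₗ[(φ.symm : B →+* C)] ((restrictAlong φ).obj M).obj :=
    { AddEquiv.refl M.obj with
      map_smul' := fun b x => by
        change b • x = φ (φ.symm b) • x
        rw [φ.apply_symm_apply] }
  exact Module.Projective.of_equiv e

/-- The `A_n`-module `Hom(E, X)`. -/
abbrev homE (X : FLMod (Lam k n)) : FLMod (Aus k n) :=
  FLMod.of (Gen k n →ₗ[Lam k n] X.obj) (isFiniteLength_hom k n X)

/-- The map `Cok Hom(E, X → Y) → Hom(E, Y/X)` induced by the projection `Y → Y/X`. -/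
def cokToHom (u : Arrow (FLMod (Lam k n))) : (alpha k n).obj u ⟶ homE (coker u) :=
  FLMod.ofHom (N := homE (coker u)) <| Submodule.liftQ _ (homMap (cokerProj u)) <| by
    rintro _ ⟨g, rfl⟩
    exact LinearMap.ext fun v => (Submodule.Quotient.mk_eq_zero _).mpr ⟨g v, rfl⟩

/-- The projection of `Hom(E, Y/X)` onto the cokernel of `Hom(E, Y → Y/X)`. -/
def homToCok (u : SubCat k n) : homE (coker u.obj) ⟶ (alpha k n).obj ((epsilon k n).obj u) :=
  FLMod.ofHom (M := homE (coker u.obj)) <|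
    Submodule.mkQ (LinearMap.range (homMap (cokerProj u.obj)))

/-- The map `Hom(E, Y/X) → Hom(E, Y'/X')` induced by a morphism of arrows. -/
def homCoker {u v : Arrow (FLMod (Lam k n))} (s : u ⟶ v) : homE (coker u) ⟶ homE (coker v) :=
  FLMod.ofHom (M := homE (coker u)) (N := homE (coker v)) (homMap (cokerMap s))

theorem cokToHom_naturality {u v : Arrow (FLMod (Lam k n))} (s : u ⟶ v) :
    (alpha k n).map s ≫ cokToHom v = cokToHom u ≫ homCoker s := by
  apply ObjectProperty.hom_ext
  apply ModuleCat.hom_ext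
  apply Submodule.linearMap_qext
  rfl

theorem homToCok_naturality {u v : SubCat k n} (s : u ⟶ v) :
    homCoker s.hom ≫ homToCok v = homToCok u ≫ (alpha k n).map ((epsilon k n).map s) := rfl

theorem cokToHom_injective (u : SubCat k n) : Function.Injective (FLMod.lin (cokToHom u.obj)) := by
  rw [injective_iff_map_eq_zero]
  intro x hx
  obtain ⟨g, rfl⟩ := Submodule.Quotient.mk_surjective _ x
  have hg : ∀ v, g v ∈ LinearMap.range (FLMod.lin u.obj.hom) := fun v =>
    (Submodule.Quotient.mk_eq_zero _).mp (LinearMap.congr_fun hx v)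
  let e := LinearEquiv.ofInjective (FLMod.lin u.obj.hom) u.property
  refine (Submodule.Quotient.mk_eq_zero _).mpr
    ⟨e.symm.toLinearMap ∘ₗ g.codRestrict _ hg, LinearMap.ext fun v => ?_⟩
  exact congrArg Subtype.val (e.apply_symm_apply _)

theorem range_cokToHom (u : SubCat k n) :
    LinearMap.range (FLMod.lin (cokToHom u.obj)) = LinearMap.ker (FLMod.lin (homToCok u)) :=
  (Submodule.range_liftQ _ _ _).trans (Submodule.ker_mkQ _).symm

/-- For `X ⊆ Y` the sequence `0 → Cok Hom(E, X → Y) → Hom(E, Y/X) → Cok Hom(E, Y → Y/X) → 0`,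
reduced modulo `⟨e⟩`. -/
def presFG (hn : 1 ≤ n) (φ : Preproj k (n - 1) ≃ₐ[k] (Aus k n ⧸ Aus.eIdeal k n))
    (u : SubCat k n) : ProjPres ((functorF k n φ).obj u) ((functorG k n φ).obj u) :=
  have hex := modIdeal_exact (Aus.eIdeal k n) (span_le_mul_self Aus.e_mul_e) _ _
    (cokToHom_injective u) (range_cokToHom u)
    (eIdeal_le_annihilator hn ((epsilon k n).obj u) (Submodule.mkQ_surjective _))
  { P := (delta k n φ).obj (homE (coker u.obj))
    i := FLMod.lin ((delta k n φ).map (cokToHom u.obj))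
    p := FLMod.lin ((delta k n φ).map (homToCok u))
    projective := by
      obtain ⟨_, _⟩ := isFiniteLength_iff_isNoetherian_isArtinian.mp (coker u.obj).property
      have := projective_hom (k := k) (n := n) (coker u.obj).obj
      exact projective_restrictAlong _ ((modIdeal (Aus.eIdeal k n)).obj (homE (coker u.obj)))
        (projective_modIdeal (Aus.eIdeal k n))
    injective := hex.1
    exact := SetLike.ext fun x => SetLike.ext_iff.mp hex.2 x
    surjective := modIdealMap_surjective (Aus.eIdeal k n) (FLMod.lin (homToCok u))
      (Submodule.mkQ_surjective _) }

theorem covers_presFG (hn : 1 ≤ n) (φ : Preproj k (n - 1) ≃ₐ[k] (Aus k n ⧸ Aus.eIdeal k n))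
    {u v : SubCat k n} (s : u ⟶ v) :
    ProjPres.Covers (presFG hn φ u) (presFG hn φ v) ((functorG k n φ).map s)
      ((functorF k n φ).map s) := by
  refine ⟨FLMod.lin ((delta k n φ).map (homCoker s.hom)), ?_, ?_⟩
  · exact congrArg FLMod.lin (((delta k n φ).map_comp _ _).symm.trans
      ((congrArg (delta k n φ).map (homToCok_naturality s)).trans ((delta k n φ).map_comp _ _)))
  · exact congrArg FLMod.lin (((delta k n φ).map_comp _ _).symm.trans
      ((congrArg (delta k n φ).map (cokToHom_naturality s.hom)).trans
        ((delta k n φ).map_comp _ _)))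

end Sequence

/-! ### Matrix units in the Auslander algebra -/

section MatrixUnits

variable {k : Type u} [Field k] {n : ℕ}

open Polynomial

/-- The endomorphism of `E` which maps the summand `[i + 1]` to the summand `[j + 1]` by
`1 ↦ x ^ q`, and the other summands to zero. It is set to zero if this makes no sense, that is,
unless `i, j < n` and `j ≤ i + q`. -/
def Gen.unit (k : Type u) [Field k] (n i j q : ℕ) : Module.End (Lam k n) (Gen k n) :=
  if h : i < n ∧ j < n ∧ j ≤ i + q then
    Gen.single ⟨j, h.2.1⟩ ∘ₗ Cyc.lift (i + 1) (Cyc.mk k n (j + 1) (X ^ q)) (by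
      rw [Cyc.x_pow_smul_mk, ← pow_add]
      exact Cyc.mk_eq_zero_of_dvd (pow_dvd_pow X (by omega))) ∘ₗ Gen.proj ⟨i, h.1⟩
  else 0

theorem Gen.unit_single {i j q : ℕ} (hi : i < n) (hj : j < n) (h : j ≤ i + q) (g : k[X]) :
    Gen.unit k n i j q (Gen.single ⟨i, hi⟩ (Cyc.mk k n (i + 1) g)) =
      Gen.single ⟨j, hj⟩ (Cyc.mk k n (j + 1) (g * X ^ q)) := by
  rw [Gen.unit, dif_pos ⟨hi, hj, h⟩, LinearMap.comp_apply, LinearMap.comp_apply,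
    Gen.proj_single_same, Cyc.lift_mk, Cyc.smul_mk]

theorem Gen.unit_single_of_ne {i i' j q : ℕ} (hi : i' < n) (h : i' ≠ i)
    (v : Cyc k n (i' + 1)) : Gen.unit k n i j q (Gen.single ⟨i', hi⟩ v) = 0 := by
  rw [Gen.unit]
  split_ifs with h1
  · rw [LinearMap.comp_apply, LinearMap.comp_apply, Gen.proj_single_of_ne, map_zero, map_zero]
    exact fun h2 => h (Fin.ext_iff.mp h2).symm
  · rfl

theorem Gen.proj_single_mk {i j : Fin n} (h : i.val = j.val) (g : k[X]) :
    Gen.proj j (Gen.single i (Cyc.mk k n (i.val + 1) g)) = Cyc.mk k n (j.val + 1) g := by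
  obtain rfl := Fin.ext h
  exact Gen.proj_single_same _ _

theorem Gen.hom_ext {M : Type*} [AddCommGroup M] [Module (Lam k n) M]
    {f g : Gen k n →ₗ[Lam k n] M}
    (h : ∀ i : Fin n, f (Gen.single i (Cyc.mk k n _ 1)) = g (Gen.single i (Cyc.mk k n _ 1))) :
    f = g := by
  refine LinearMap.ext fun v => ?_
  rw [← Gen.sum_single_proj v, map_sum, map_sum]
  refine Finset.sum_congr rfl fun i _ => ?_
  exact LinearMap.congr_fun (Cyc.linearMap_ext (f := f ∘ₗ Gen.single i) (g := g ∘ₗ Gen.single i)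
    (h i)) _

theorem Gen.unit_eq_zero {i j q : ℕ} (h : ¬(i < n ∧ j < n ∧ j ≤ i + q)) :
    Gen.unit k n i j q = 0 := dif_neg h

theorem Gen.unit_eq_zero_of_lt {i j q : ℕ} (h : j < q) : Gen.unit k n i j q = 0 := by
  by_cases hv : i < n ∧ j < n ∧ j ≤ i + q
  · refine Gen.hom_ext fun i' => ?_
    by_cases hi : i'.val = i
    · subst hi
      rw [Gen.unit_single i'.2 hv.2.1 hv.2.2, Cyc.mk_eq_zero_of_dvd, map_zero]
      · rfl
      · exact dvd_mul_of_dvd_right (pow_dvd_pow X h) 1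
    · rw [Gen.unit_single_of_ne i'.2 hi]
      rfl
  · exact Gen.unit_eq_zero hv

theorem Gen.unit_mul {i j l q r : ℕ} (hj : j < n) (h : j ≤ i + q) (h' : l ≤ j + r) :
    Gen.unit k n j l r * Gen.unit k n i j q = Gen.unit k n i l (q + r) := by
  by_cases hl : l < n
  · refine Gen.hom_ext fun i' => ?_
    rw [Module.End.mul_apply]
    by_cases hi : i'.val = i
    · subst hi
      rw [Gen.unit_single i'.2 hj h, Gen.unit_single hj hl h',
        Gen.unit_single i'.2 hl (by omega), mul_assoc, ← pow_add]
    · rw [Gen.unit_single_of_ne i'.2 hi, Gen.unit_single_of_ne i'.2 hi, map_zero]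
  · rw [Gen.unit_eq_zero fun h => hl h.2.1, Gen.unit_eq_zero fun h => hl h.2.1, zero_mul]

theorem Gen.unit_mul_of_ne {i j j' l q r : ℕ} (h : j ≠ j') :
    Gen.unit k n j' l r * Gen.unit k n i j q = 0 := by
  by_cases hv : i < n ∧ j < n ∧ j ≤ i + q
  · refine Gen.hom_ext fun i' => ?_
    rw [Module.End.mul_apply]
    by_cases hi : i'.val = i
    · subst hi
      rw [Gen.unit_single i'.2 hv.2.1 hv.2.2, Gen.unit_single_of_ne hv.2.1 h]
      rfl
    · rw [Gen.unit_single_of_ne i'.2 hi, map_zero]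
      rfl
  · rw [Gen.unit_eq_zero hv, mul_zero]

theorem Gen.sum_unit : ∑ i ∈ Finset.range n, Gen.unit k n i i 0 = 1 := by
  refine Gen.hom_ext fun i => ?_
  rw [LinearMap.sum_apply, Finset.sum_eq_single i.val, Gen.unit_single i.2 i.2 le_self_add,
    pow_zero, mul_one]
  · rfl
  · exact fun b _ hb => Gen.unit_single_of_ne i.2 hb.symm _
  · exact fun h => absurd (Finset.mem_range.mpr i.2) h

theorem Gen.projLast_eq_unit (hn : 1 ≤ n) :
    Gen.projLast k n = Gen.unit k n (n - 1) (n - 1) 0 := by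
  have hl : n - 1 < n := by omega
  rw [Gen.projLast_eq ⟨n - 1, hl⟩ (Nat.sub_add_cancel hn)]
  refine Gen.hom_ext fun i => ?_
  by_cases hi : i.val = n - 1
  · obtain ⟨i, hi'⟩ := i
    dsimp only at hi
    subst hi
    rw [Gen.unit_single hl hl le_self_add, pow_zero, mul_one, LinearMap.comp_apply,
      Gen.proj_single_same]
  · rw [Gen.unit_single_of_ne i.2 hi, LinearMap.comp_apply, Gen.proj_single_of_ne, map_zero]
    exact fun h => hi (Fin.ext_iff.mp h).symm

/-- The class of an endomorphism of `E` in `A_n/⟨e⟩`. -/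
def Aus.cls (k : Type u) [Field k] (n : ℕ) :
    Module.End (Lam k n) (Gen k n) →ₗ[k] (Aus k n ⧸ Aus.eIdeal k n) :=
  (Ideal.Quotient.mkₐ k (Aus.eIdeal k n)).toLinearMap ∘ₗ
    (MulOpposite.opLinearEquiv k).toLinearMap

theorem Aus.cls_surjective : Function.Surjective (Aus.cls k n) :=
  Ideal.Quotient.mk_surjective.comp MulOpposite.op_surjective

theorem Aus.cls_mul (f g : Module.End (Lam k n) (Gen k n)) :
    Aus.cls k n (f * g) = Aus.cls k n g * Aus.cls k n f :=
  map_mul (Ideal.Quotient.mk (Aus.eIdeal k n)) (MulOpposite.op g) (MulOpposite.op f)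

theorem Aus.cls_one : Aus.cls k n 1 = 1 := map_one (Ideal.Quotient.mk (Aus.eIdeal k n))

theorem Aus.cls_projLast : Aus.cls k n (Gen.projLast k n) = 0 :=
  Ideal.Quotient.eq_zero_iff_mem.mpr (TwoSidedIdeal.subset_span rfl)

/-- The class of a matrix unit in `A_n/⟨e⟩`. -/
def Aus.unit (k : Type u) [Field k] (n i j q : ℕ) : Aus k n ⧸ Aus.eIdeal k n :=
  Aus.cls k n (Gen.unit k n i j q)

theorem Aus.unit_mul {i j l q r : ℕ} (hj : j < n) (h : j ≤ i + q) (h' : l ≤ j + r) :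
    Aus.unit k n i j q * Aus.unit k n j l r = Aus.unit k n i l (q + r) := by
  rw [Aus.unit, Aus.unit, ← Aus.cls_mul, Gen.unit_mul hj h h', Aus.unit]

theorem Aus.unit_mul_of_ne {i j j' l q r : ℕ} (h : j ≠ j') :
    Aus.unit k n i j q * Aus.unit k n j' l r = 0 := by
  rw [Aus.unit, Aus.unit, ← Aus.cls_mul, Gen.unit_mul_of_ne h, map_zero]

/-- For `q ≥ n - 1 - i` the matrix unit factors through the summand `[n]`. -/
theorem Aus.unit_eq_zero (hn : 1 ≤ n) {i j q : ℕ} (h : n ≤ i + q + 1) : Aus.unit k n i j q = 0 := by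
  by_cases hv : i < n ∧ j < n ∧ j ≤ i + q
  · have hl : n - 1 < n := by omega
    have h1 : Aus.unit k n i (n - 1) (n - 1 - i) * Aus.unit k n (n - 1) (n - 1) 0 *
        Aus.unit k n (n - 1) j (q - (n - 1 - i)) = Aus.unit k n i j q := by
      rw [Aus.unit_mul hl (by omega) (by omega), Aus.unit_mul hl (by omega) (by omega)]
      congr 1
      omega
    rw [← h1, Aus.unit.eq_1 k n (n - 1), ← Gen.projLast_eq_unit hn, Aus.cls_projLast, mul_zero,
      zero_mul]
  · rw [Aus.unit, Gen.unit_eq_zero hv, map_zero]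

theorem Aus.unit_eq_zero_of_lt {i j q : ℕ} (h : j < q) : Aus.unit k n i j q = 0 := by
  rw [Aus.unit, Gen.unit_eq_zero_of_lt h, map_zero]

theorem Aus.sum_unit (hn : 1 ≤ n) : ∑ i ∈ Finset.range (n - 1), Aus.unit k n i i 0 = 1 := by
  have h : ∑ i ∈ Finset.range (n - 1 + 1), Aus.unit k n i i 0 = 1 := by
    rw [Nat.sub_add_cancel hn, ← Aus.cls_one, ← Gen.sum_unit, map_sum]
    rfl
  rwa [Finset.sum_range_succ, Aus.unit_eq_zero hn (by omega), add_zero] at h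

/-- The matrix units span `A_n/⟨e⟩`. -/
theorem Aus.mem_of_unit_mem (W : Submodule k (Aus k n ⧸ Aus.eIdeal k n))
    (h : ∀ i j q, i < n → j < n → j ≤ i + q → Aus.unit k n i j q ∈ W)
    (z : Aus k n ⧸ Aus.eIdeal k n) : z ∈ W := by
  obtain ⟨f, rfl⟩ := Aus.cls_surjective z
  -- `g i j` represents the image of the generator of `[i + 1]` in `[j + 1]`. That this image is
  -- annihilated by `x ^ (i + 1)` excludes the monomials to which no matrix unit corresponds.
  choose g hg using fun (i j : Fin n) =>
    Cyc.mk_surjective (j.val + 1) (Gen.proj j (f (Gen.single i (Cyc.mk k n _ 1))))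
  have hdvd : ∀ i j : Fin n, (X : k[X]) ^ (j.val + 1) ∣ X ^ (i.val + 1) * g i j := fun i j => by
    rw [← Cyc.mk_eq_zero_iff j.2, ← Cyc.x_pow_smul_mk, hg, ← map_smul, ← map_smul, ← map_smul,
      Cyc.x_pow_smul_mk, Cyc.mk_eq_zero_of_dvd (Dvd.intro _ rfl), map_zero, map_zero, map_zero]
  have hcoeff : ∀ (i j : Fin n) (q : ℕ), q ∈ (g i j).support → j.val ≤ i.val + q :=
    fun i j q hq => by
      by_contra hlt
      have := X_pow_dvd_iff.mp (hdvd i j) (q + (i.val + 1)) (by omega)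
      rw [coeff_X_pow_mul] at this
      exact mem_support_iff.mp hq this
  have hf : f = ∑ i : Fin n, ∑ j : Fin n, ∑ q ∈ (g i j).support,
      (g i j).coeff q • Gen.unit k n i j q := by
    refine Gen.hom_ext fun i => ?_
    rw [LinearMap.sum_apply, Finset.sum_eq_single i]
    · rw [← Gen.sum_single_proj (f _), LinearMap.sum_apply]
      refine Finset.sum_congr rfl fun j _ => ?_
      rw [← hg, LinearMap.sum_apply]
      conv_lhs => rw [(g i j).as_sum_support, map_sum, map_sum]
      refine Finset.sum_congr rfl fun q hq => ?_
      rw [LinearMap.smul_apply, Gen.unit_single i.2 j.2 (hcoeff i j q hq), one_mul,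
        ← smul_X_eq_monomial, map_smul, LinearMap.map_smul_of_tower]
    · intro i' _ hi'
      rw [LinearMap.sum_apply]
      refine Finset.sum_eq_zero fun j _ => ?_
      rw [LinearMap.sum_apply]
      refine Finset.sum_eq_zero fun q _ => ?_
      rw [LinearMap.smul_apply, Gen.unit_single_of_ne i.2 fun h => hi' (Fin.ext h.symm), smul_zero]
    · exact fun h => absurd (Finset.mem_univ i) h
  rw [hf]
  simp only [map_sum, map_smul]
  refine Submodule.sum_mem _ fun i _ => Submodule.sum_mem _ fun j _ => Submodule.sum_mem _
    fun q hq => Submodule.smul_mem _ _ (h _ _ _ i.2 j.2 (hcoeff i j q hq))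

/-- The endomorphisms of `E` mapping the kernel of `x ^ a` into `x ^ (n - a) E`, for all `a`. This
two-sided ideal contains (in fact equals) `⟨e⟩`. -/
def Aus.kerIdeal (k : Type u) [Field k] (n : ℕ) : Ideal (Aus k n) where
  carrier := {f | ∀ (a : ℕ) (v : Gen k n), Lam.x k n ^ a • v = 0 →
    ∃ w, f.unop v = Lam.x k n ^ (n - a) • w}
  add_mem' := by
    intro f g hf hg a v hv
    obtain ⟨w, hw⟩ := hf a v hv
    obtain ⟨w', hw'⟩ := hg a v hv
    exact ⟨w + w', by rw [smul_add, ← hw, ← hw']; rfl⟩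
  zero_mem' := fun a v _ => ⟨0, (smul_zero _).symm⟩
  smul_mem' := by
    intro c f hf a v hv
    exact hf a (c.unop v) (by rw [← map_smul, hv, map_zero])

instance : (Aus.kerIdeal k n).IsTwoSided where
  mul_mem_of_left := by
    intro f c hf a v hv
    obtain ⟨w, hw⟩ := hf a v hv
    exact ⟨c.unop w, by rw [← map_smul, ← hw]; rfl⟩

theorem Aus.eIdeal_le_kerIdeal (hn : 1 ≤ n) : Aus.eIdeal k n ≤ Aus.kerIdeal k n := by
  refine span_asIdeal_le fun a v hv => ?_
  by_cases ha : n ≤ a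
  · exact ⟨_, by rw [Nat.sub_eq_zero_of_le ha, pow_zero]; exact (one_smul (Lam k n) _).symm⟩
  let l : Fin n := ⟨n - 1, by omega⟩
  have hl : l.val + 1 = n := Nat.sub_add_cancel hn
  obtain ⟨g, hg⟩ := Cyc.mk_surjective _ (Gen.proj l v)
  have h1 : (X : k[X]) ^ n ∣ X ^ a * g := by
    conv_lhs => rw [← hl]
    rw [← Cyc.mk_eq_zero_iff hl.le, ← Cyc.x_pow_smul_mk, hg, ← map_smul, hv, map_zero]
  have h2 : (X : k[X]) ^ (n - a) ∣ g := by
    rw [← Nat.add_sub_of_le (not_le.mp ha).le, pow_add] at h1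
    exact (mul_dvd_mul_iff_left (pow_ne_zero a X_ne_zero)).mp h1
  obtain ⟨c, rfl⟩ := h2
  refine ⟨Gen.single l (Cyc.mk k n _ c), ?_⟩
  rw [← map_smul, Cyc.x_pow_smul_mk, hg]
  exact LinearMap.congr_fun (Gen.projLast_eq l hl) v

/-- The matrix units `(i, j, q)` with `q ≤ j`, `i + q < n - 1` are linearly independent modulo
`⟨e⟩`. They are indexed here by `(i, p, q)` with `j = i - p + q`. -/
theorem Aus.linearIndependent_unit (hn : 1 ≤ n) :
    LinearIndependent k fun t : {t : ℕ × ℕ × ℕ // t.2.1 ≤ t.1 ∧ t.1 + t.2.2 < n - 1} =>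
      Aus.unit k n t.1.1 (t.1.1 - t.1.2.1 + t.1.2.2) t.1.2.2 := by
  rw [linearIndependent_iff']
  intro s c hc t₀ ht₀
  have hmem : MulOpposite.op (∑ t ∈ s, c t •
      Gen.unit k n t.1.1 (t.1.1 - t.1.2.1 + t.1.2.2) t.1.2.2) ∈ Aus.eIdeal k n := by
    rw [← Ideal.Quotient.eq_zero_iff_mem, ← hc]
    refine (map_sum (Aus.cls k n) _ _).trans ?_
    simp only [map_smul]
    rfl
  obtain ⟨⟨i, p, q⟩, hp, hq⟩ := t₀
  dsimp only at hp hq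
  have hi : i < n := by omega
  have hj : i - p + q < n := by omega
  obtain ⟨w, hw⟩ := Aus.eIdeal_le_kerIdeal hn hmem (i + 1) (Gen.single ⟨i, hi⟩ (Cyc.mk k n _ 1)) (by
    rw [← map_smul, Cyc.x_pow_smul_mk, Cyc.mk_eq_zero_of_dvd (Dvd.intro _ rfl), map_zero])
  obtain ⟨g, hg⟩ := Cyc.mk_surjective _ (Gen.proj ⟨i - p + q, hj⟩ w)
  -- The combination is evaluated at the generator of `[i + 1]`, which is annihilated by
  -- `x ^ (i + 1)`. Its component in the summand `[j + 1]`, `j = i - p + q`, is the class of `P`, and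
  -- it lies in `x ^ (n - (i + 1)) [j + 1]`. As `q ≤ j` and `q < n - (i + 1)`, the coefficient of
  -- `x ^ q` in `P`, which is the given scalar, vanishes.
  let P : k[X] := ∑ t ∈ s, c t •
    if t.1.1 = i ∧ t.1.1 - t.1.2.1 + t.1.2.2 = i - p + q then X ^ t.1.2.2 else 0
  have h1 : Cyc.mk k n (i - p + q + 1) P = Cyc.mk k n (i - p + q + 1) (X ^ (n - (i + 1)) * g) := by
    rw [← Cyc.x_pow_smul_mk, hg, ← map_smul, ← hw, MulOpposite.unop_op, LinearMap.sum_apply,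
      map_sum, map_sum]
    refine Finset.sum_congr rfl fun t _ => ?_
    rw [map_smul, LinearMap.smul_apply, LinearMap.map_smul_of_tower]
    congr 1
    obtain ⟨⟨i', p', q'⟩, hp', hq'⟩ := t
    dsimp only at hp' hq' ⊢
    by_cases hii : i' = i
    · subst hii
      rw [Gen.unit_single hi (by omega) (by omega), one_mul]
      by_cases hjj : i' - p' + q' = i' - p + q
      · rw [if_pos ⟨rfl, hjj⟩]
        exact (Gen.proj_single_mk (j := ⟨i' - p + q, hj⟩) hjj _).symm
      · rw [if_neg fun h => hjj h.2, map_zero, Gen.proj_single_of_ne]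
        exact fun h => hjj (Fin.ext_iff.mp h).symm
    · rw [if_neg fun h => hii h.1, map_zero, Gen.unit_single_of_ne hi (Ne.symm hii), map_zero]
  have h2 : (X : k[X]) ^ (i - p + q + 1) ∣ P - X ^ (n - (i + 1)) * g := by
    rw [← Cyc.mk_eq_zero_iff hj, map_sub, h1, sub_self]
  have h3 := X_pow_dvd_iff.mp h2 q (by omega)
  rw [coeff_sub, coeff_X_pow_mul', if_neg (by omega), sub_zero, finsetSum_coeff,
    Finset.sum_eq_single ⟨⟨i, p, q⟩, hp, hq⟩] at h3
  · simpa using h3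
  · rintro ⟨⟨i', p', q'⟩, hp', hq'⟩ _ hne
    dsimp only at hp' hq' ⊢
    rw [coeff_smul]
    split_ifs with h
    · rw [coeff_X_pow, if_neg, smul_zero]
      rintro rfl
      refine hne (Subtype.ext (Prod.ext h.1 (Prod.ext ?_ rfl)))
      dsimp only
      omega
    · rw [coeff_zero, smul_zero]
  · exact fun h => absurd ht₀ h

end MatrixUnits

/-! ### Generators and normal forms in the preprojective algebra -/

namespace Preproj

variable (k : Type u) [Field k] (m : ℕ)

/-- The class of an element of the free algebra in `Π_m`. -/
def mk : FreeAlgebra k (PreprojGen (Fin m) (Fin (m - 1))) →ₐ[k] Preproj k m :=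
  RingQuot.mkAlgHom k _

/-- The trivial path at the vertex `i`, and zero if there is no such vertex. -/
def vert (i : ℕ) : Preproj k m := if h : i < m then mk k m (.ι k (.vertex ⟨i, h⟩)) else 0

/-- The arrow `i → i + 1`, and zero if there is no such arrow. -/
def arr (i : ℕ) : Preproj k m := if h : i < m - 1 then mk k m (.ι k (.arrow ⟨i, h⟩)) else 0

/-- The arrow `i + 1 → i`, and zero if there is no such arrow. -/
def opp (i : ℕ) : Preproj k m := if h : i < m - 1 then mk k m (.ι k (.opp ⟨i, h⟩)) else 0

/-- The sum of the arrows `i → i + 1`. -/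
def arrSum : Preproj k m := ∑ i ∈ Finset.range (m - 1), arr k m i

/-- The sum of the arrows `i + 1 → i`. -/
def oppSum : Preproj k m := ∑ i ∈ Finset.range (m - 1), opp k m i

variable {k m}

theorem vert_of_lt {i : ℕ} (h : i < m) : vert k m i = mk k m (.ι k (.vertex ⟨i, h⟩)) := dif_pos h

theorem vert_of_le {i : ℕ} (h : m ≤ i) : vert k m i = 0 := dif_neg h.not_gt

theorem arr_of_lt {i : ℕ} (h : i < m - 1) : arr k m i = mk k m (.ι k (.arrow ⟨i, h⟩)) := dif_pos h

theorem opp_of_lt {i : ℕ} (h : i < m - 1) : opp k m i = mk k m (.ι k (.opp ⟨i, h⟩)) := dif_pos h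

theorem arr_of_le {i : ℕ} (h : m - 1 ≤ i) : arr k m i = 0 := dif_neg h.not_gt

theorem opp_of_le {i : ℕ} (h : m - 1 ≤ i) : opp k m i = 0 := dif_neg h.not_gt

theorem vert_mul_vert (i j : ℕ) : vert k m i * vert k m j = if i = j then vert k m i else 0 := by
  by_cases hi : i < m
  · by_cases hj : j < m
    · rw [vert_of_lt hi, vert_of_lt hj, ← map_mul]
      split_ifs with h
      · subst h
        exact RingQuot.mkAlgHom_rel k (.idem _)
      · rw [← map_zero (mk k m)]
        exact RingQuot.mkAlgHom_rel k (.orth _ _ fun h' => h (Fin.ext_iff.mp h'))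
    · rw [vert_of_le (not_lt.mp hj), mul_zero, if_neg (by omega)]
  · rw [vert_of_le (not_lt.mp hi), zero_mul, ite_self]

theorem vert_mul_self (i : ℕ) : vert k m i * vert k m i = vert k m i := by
  rw [vert_mul_vert, if_pos rfl]

theorem sum_vert : ∑ i ∈ Finset.range m, vert k m i = 1 := by
  rw [Finset.sum_range, ← map_one (mk k m)]
  refine Eq.trans ?_ (RingQuot.mkAlgHom_rel k (PreprojRel.sum_vertex (k := k)))
  rw [map_sum]
  exact Finset.sum_congr rfl fun i _ => vert_of_lt i.2

theorem vert_arr_vert (i : ℕ) : vert k m (i + 1) * arr k m i * vert k m i = arr k m i := by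
  by_cases h : i < m - 1
  · rw [vert_of_lt (show i + 1 < m by omega), vert_of_lt (show i < m by omega), arr_of_lt h,
      ← map_mul, ← map_mul]
    exact RingQuot.mkAlgHom_rel k (PreprojRel.arrow
      (s := fun i : Fin (m - 1) => (⟨i.val, by omega⟩ : Fin m))
      (t := fun i => ⟨i.val + 1, by omega⟩) ⟨i, h⟩)
  · rw [arr_of_le (not_lt.mp h), mul_zero, zero_mul]

theorem vert_opp_vert (i : ℕ) : vert k m i * opp k m i * vert k m (i + 1) = opp k m i := by
  by_cases h : i < m - 1
  · rw [vert_of_lt (show i + 1 < m by omega), vert_of_lt (show i < m by omega), opp_of_lt h,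
      ← map_mul, ← map_mul]
    exact RingQuot.mkAlgHom_rel k (PreprojRel.opp
      (s := fun i : Fin (m - 1) => (⟨i.val, by omega⟩ : Fin m))
      (t := fun i => ⟨i.val + 1, by omega⟩) ⟨i, h⟩)
  · rw [opp_of_le (not_lt.mp h), mul_zero, zero_mul]

theorem vert_mul_arr (i j : ℕ) : vert k m j * arr k m i = if j = i + 1 then arr k m i else 0 := by
  conv_lhs => rw [← vert_arr_vert, ← mul_assoc, ← mul_assoc, vert_mul_vert]
  split_ifs with h
  · rw [h, vert_arr_vert]
  · rw [zero_mul, zero_mul]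

theorem arr_mul_vert (i j : ℕ) : arr k m i * vert k m j = if j = i then arr k m i else 0 := by
  conv_lhs => rw [← vert_arr_vert, mul_assoc, vert_mul_vert]
  split_ifs with h h' h'
  · rw [vert_arr_vert]
  · exact absurd h.symm h'
  · exact absurd h'.symm h
  · rw [mul_zero]

theorem vert_mul_opp (i j : ℕ) : vert k m j * opp k m i = if j = i then opp k m i else 0 := by
  conv_lhs => rw [← vert_opp_vert, ← mul_assoc, ← mul_assoc, vert_mul_vert]
  split_ifs with h
  · rw [h, vert_opp_vert]
  · rw [zero_mul, zero_mul]

theorem opp_mul_vert (i j : ℕ) : opp k m i * vert k m j = if j = i + 1 then opp k m i else 0 := by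
  conv_lhs => rw [← vert_opp_vert, mul_assoc, vert_mul_vert]
  split_ifs with h h' h'
  · rw [vert_opp_vert]
  · exact absurd h.symm h'
  · exact absurd h'.symm h
  · rw [mul_zero]

theorem sum_range_ite {M : Type*} [AddCommMonoid M] (f : ℕ → M) {r : ℕ} (hf : ∀ i, r ≤ i → f i = 0)
    (j : ℕ) : (∑ i ∈ Finset.range r, if j = i then f i else 0) = f j := by
  rw [Finset.sum_ite_eq, ite_eq_left_iff]
  exact fun h => (hf j (not_lt.mp fun h' => h (Finset.mem_range.mpr h'))).symm

theorem arrSum_mul_vert (i : ℕ) : arrSum k m * vert k m i = arr k m i := by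
  rw [arrSum, Finset.sum_mul]
  simp only [arr_mul_vert]
  exact sum_range_ite _ (fun _ => arr_of_le) i

theorem vert_succ_mul_arrSum (i : ℕ) : vert k m (i + 1) * arrSum k m = arr k m i := by
  rw [arrSum, Finset.mul_sum]
  simp only [vert_mul_arr, add_left_inj]
  exact sum_range_ite _ (fun _ => arr_of_le) i

theorem vert_zero_mul_arrSum : vert k m 0 * arrSum k m = 0 := by
  rw [arrSum, Finset.mul_sum]
  exact Finset.sum_eq_zero fun i _ => by rw [vert_mul_arr, if_neg (Nat.succ_ne_zero i).symm]

theorem oppSum_mul_vert_succ (i : ℕ) : oppSum k m * vert k m (i + 1) = opp k m i := by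
  rw [oppSum, Finset.sum_mul]
  simp only [opp_mul_vert, add_left_inj]
  exact sum_range_ite _ (fun _ => opp_of_le) i

theorem oppSum_mul_vert_zero : oppSum k m * vert k m 0 = 0 := by
  rw [oppSum, Finset.sum_mul]
  exact Finset.sum_eq_zero fun i _ => by rw [opp_mul_vert, if_neg (Nat.succ_ne_zero i).symm]

theorem vert_mul_oppSum (i : ℕ) : vert k m i * oppSum k m = opp k m i := by
  rw [oppSum, Finset.mul_sum]
  simp only [vert_mul_opp]
  exact sum_range_ite _ (fun _ => opp_of_le) i

/-- For the linear quiver the preprojective relation says that the sum of the arrows commutes with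
the sum of the opposite arrows. -/
theorem arrSum_commute_oppSum : Commute (arrSum k m) (oppSum k m) := by
  have h1 : arrSum k m * oppSum k m = ∑ i ∈ Finset.range (m - 1), arr k m i * opp k m i := by
    conv_lhs => rw [arrSum, Finset.sum_mul]
    refine Finset.sum_congr rfl fun i _ => ?_
    rw [← vert_mul_oppSum, ← mul_assoc, arr_mul_vert, if_pos rfl]
  have h2 : oppSum k m * arrSum k m = ∑ i ∈ Finset.range (m - 1), opp k m i * arr k m i := by
    conv_lhs => rw [oppSum, Finset.sum_mul]
    refine Finset.sum_congr rfl fun i _ => ?_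
    rw [← vert_succ_mul_arrSum, ← mul_assoc, opp_mul_vert, if_pos rfl]
  have h3 := RingQuot.mkAlgHom_rel k (PreprojRel.preproj (k := k)
    (s := fun i : Fin (m - 1) => (⟨i.val, by omega⟩ : Fin m))
    (t := fun i => ⟨i.val + 1, by omega⟩))
  rw [map_sum, map_zero] at h3
  rw [Commute, SemiconjBy, h1, h2, ← sub_eq_zero, ← Finset.sum_sub_distrib, Finset.sum_range,
    ← h3]
  refine Finset.sum_congr rfl fun i _ => ?_
  rw [arr_of_lt i.2, opp_of_lt i.2, map_sub, map_mul, map_mul]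
  rfl

theorem arrSum_pow_mul_vert (p i : ℕ) :
    arrSum k m ^ p * vert k m i = vert k m (i + p) * arrSum k m ^ p := by
  induction p with
  | zero => simp
  | succ p ih =>
    rw [pow_succ', mul_assoc, ih, ← mul_assoc, arrSum_mul_vert, ← vert_succ_mul_arrSum, mul_assoc,
      add_assoc]

theorem vert_mul_oppSum_pow (q i : ℕ) :
    vert k m i * oppSum k m ^ q = oppSum k m ^ q * vert k m (i + q) := by
  induction q with
  | zero => simp
  | succ q ih =>
    rw [pow_succ, ← mul_assoc, ih, mul_assoc, vert_mul_oppSum, ← oppSum_mul_vert_succ, ← mul_assoc,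
      add_assoc]

theorem vert_mul_arrSum_pow_eq_zero {p i : ℕ} (h : i < p) : vert k m i * arrSum k m ^ p = 0 := by
  obtain ⟨r, rfl⟩ := Nat.exists_eq_add_of_lt h
  have h1 := arrSum_pow_mul_vert (k := k) (m := m) i 0
  rw [zero_add] at h1
  rw [add_assoc, pow_add, ← mul_assoc, ← h1, add_comm, pow_add, pow_one, mul_assoc,
    ← mul_assoc (vert k m 0), vert_zero_mul_arrSum, zero_mul, mul_zero]

theorem oppSum_pow_mul_vert_eq_zero {q i : ℕ} (h : i < q) : oppSum k m ^ q * vert k m i = 0 := by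
  obtain ⟨r, rfl⟩ := Nat.exists_eq_add_of_lt h
  have h1 := vert_mul_oppSum_pow (k := k) (m := m) i 0
  rw [zero_add] at h1
  rw [add_assoc, add_comm, pow_add, mul_assoc, ← h1, pow_succ, mul_assoc,
    ← mul_assoc (oppSum k m), oppSum_mul_vert_zero, zero_mul, mul_zero]

variable (k m) in
/-- The path that starts with `q` opposite arrows, continues with `p` arrows and ends at `i`. -/
def path (i p q : ℕ) : Preproj k m := vert k m i * arrSum k m ^ p * oppSum k m ^ q

theorem path_eq_zero {i p q : ℕ} (h : ¬(p ≤ i ∧ i + q < m)) : path k m i p q = 0 := by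
  by_cases hp : p ≤ i
  · have hq : m ≤ i + q := not_lt.mp fun h' => h ⟨hp, h'⟩
    rw [path, mul_assoc, (arrSum_commute_oppSum.pow_pow p q).eq, ← mul_assoc, vert_mul_oppSum_pow,
      vert_of_le hq, mul_zero, zero_mul]
  · rw [path, vert_mul_arrSum_pow_eq_zero (not_le.mp hp), zero_mul]

theorem path_succ (j p q : ℕ) :
    path k m (j + p) p (q + 1) = path k m (j + p) p q * opp k m (j + q) := by
  have h : path k m (j + p) p q * vert k m (j + q) = path k m (j + p) p q := by
    rw [path, ← arrSum_pow_mul_vert, mul_assoc _ (vert k m j), vert_mul_oppSum_pow, mul_assoc,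
      mul_assoc, vert_mul_self]
  rw [← vert_mul_oppSum, ← mul_assoc, h, path, path, pow_succ, ← mul_assoc]

variable (k m) in
/-- The span of the paths. -/
def pathSpan : Submodule k (Preproj k m) :=
  Submodule.span k (Set.range fun t : {t : ℕ × ℕ × ℕ // t.2.1 ≤ t.1 ∧ t.1 + t.2.2 < m} =>
    path k m t.1.1 t.1.2.1 t.1.2.2)

theorem path_mem (i p q : ℕ) : path k m i p q ∈ pathSpan k m := by
  by_cases h : p ≤ i ∧ i + q < m
  · exact Submodule.subset_span ⟨⟨(i, p, q), h⟩, rfl⟩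
  · rw [path_eq_zero h]
    exact zero_mem _

theorem mul_mem_of_path {z : Preproj k m} (h : ∀ i p q, path k m i p q * z ∈ pathSpan k m)
    {w : Preproj k m} (hw : w ∈ pathSpan k m) : w * z ∈ pathSpan k m := by
  induction hw using Submodule.span_induction with
  | mem w hw =>
    obtain ⟨t, rfl⟩ := hw
    exact h _ _ _
  | zero => rw [zero_mul]; exact zero_mem _
  | add x y _ _ hx hy => rw [add_mul]; exact add_mem hx hy
  | smul c x _ hx => rw [smul_mul_assoc]; exact Submodule.smul_mem _ _ hx

theorem mul_vert_mem (j : ℕ) {w : Preproj k m} (hw : w ∈ pathSpan k m) :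
    w * vert k m j ∈ pathSpan k m := by
  refine mul_mem_of_path (fun i p q => ?_) hw
  by_cases hq : q ≤ j
  · obtain ⟨r, rfl⟩ := Nat.exists_eq_add_of_le hq
    rw [path, mul_assoc, add_comm, ← vert_mul_oppSum_pow, mul_assoc, ← mul_assoc (arrSum k m ^ p),
      arrSum_pow_mul_vert, ← mul_assoc, ← mul_assoc, vert_mul_vert]
    split_ifs with h
    · exact path_mem i p q
    · rw [zero_mul, zero_mul]
      exact zero_mem _
  · rw [path, mul_assoc, oppSum_pow_mul_vert_eq_zero (not_le.mp hq), mul_zero]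
    exact zero_mem _

theorem mul_arrSum_mem {w : Preproj k m} (hw : w ∈ pathSpan k m) :
    w * arrSum k m ∈ pathSpan k m := by
  refine mul_mem_of_path (fun i p q => ?_) hw
  rw [path, mul_assoc, ← (arrSum_commute_oppSum.pow_right q).eq, ← mul_assoc, mul_assoc (vert k m i),
    ← pow_succ]
  exact path_mem i (p + 1) q

theorem mul_oppSum_mem {w : Preproj k m} (hw : w ∈ pathSpan k m) :
    w * oppSum k m ∈ pathSpan k m := by
  refine mul_mem_of_path (fun i p q => ?_) hw
  rw [path, mul_assoc, ← pow_succ]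
  exact path_mem i p (q + 1)

theorem one_mem_pathSpan : (1 : Preproj k m) ∈ pathSpan k m := by
  rw [← sum_vert]
  refine Submodule.sum_mem _ fun i _ => ?_
  have := path_mem (k := k) (m := m) i 0 0
  rwa [path, pow_zero, pow_zero, mul_one, mul_one] at this

/-- The paths span the preprojective algebra, since their span is closed under right multiplication
by the generators. -/
theorem pathSpan_eq_top : pathSpan k m = ⊤ := by
  rw [Submodule.eq_top_iff']
  intro z
  obtain ⟨z, rfl⟩ := RingQuot.mkAlgHom_surjective k _ z
  suffices h : ∀ w ∈ pathSpan k m, w * mk k m z ∈ pathSpan k m by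
    have := h 1 one_mem_pathSpan
    rwa [one_mul] at this
  induction z using FreeAlgebra.induction with
  | grade0 r =>
    intro w hw
    rw [AlgHom.commutes, ← Algebra.commutes, ← Algebra.smul_def]
    exact Submodule.smul_mem _ _ hw
  | grade1 x =>
    intro w hw
    cases x with
    | vertex v =>
      rw [← vert_of_lt v.2]
      exact mul_vert_mem _ hw
    | arrow a =>
      rw [← arr_of_lt a.2, ← arrSum_mul_vert, ← mul_assoc]
      exact mul_vert_mem _ (mul_arrSum_mem hw)
    | opp a =>
      rw [← opp_of_lt a.2, ← oppSum_mul_vert_succ, ← mul_assoc]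
      exact mul_vert_mem _ (mul_oppSum_mem hw)
  | mul a b ha hb =>
    intro w hw
    rw [map_mul, ← mul_assoc]
    exact hb _ (ha _ hw)
  | add a b ha hb =>
    intro w hw
    rw [map_add, mul_add]
    exact add_mem (ha _ hw) (hb _ hw)

end Preproj

/-! ### The preprojective algebra as a quotient of the Auslander algebra -/

section Comparison

variable {k : Type u} [Field k] {n : ℕ}

variable (k n) in
/-- The images of the generators in `A_n/⟨e⟩`: the projection onto `[i + 1]` for the vertex `i`,
the epimorphism `[i + 2] → [i + 1]` for the arrow `i → i + 1`, and the monomorphism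
`[i + 1] → [i + 2]` for its opposite. The composition in `A_n = End(E)ᵒᵖ` reverses that of maps. -/
def Aus.preprojGen : PreprojGen (Fin (n - 1)) (Fin (n - 1 - 1)) → Aus k n ⧸ Aus.eIdeal k n
  | .vertex i => Aus.unit k n i i 0
  | .arrow i => Aus.unit k n (i + 1) i 0
  | .opp i => Aus.unit k n i (i + 1) 1

theorem Aus.preprojGen_rel (hn : 1 ≤ n)
    ⦃x y : FreeAlgebra k (PreprojGen (Fin (n - 1)) (Fin (n - 1 - 1)))⦄
    (h : PreprojRel k (V := Fin (n - 1)) (Q := Fin (n - 1 - 1))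
      (fun i => ⟨i.val, by omega⟩) (fun i => ⟨i.val + 1, by omega⟩) x y) :
    FreeAlgebra.lift k (Aus.preprojGen k n) x = FreeAlgebra.lift k (Aus.preprojGen k n) y := by
  cases h with
  | idem v =>
    simp only [map_mul, FreeAlgebra.lift_ι_apply, Aus.preprojGen]
    exact Aus.unit_mul (by omega) (by omega) (by omega)
  | orth v w h =>
    simp only [map_mul, map_zero, FreeAlgebra.lift_ι_apply, Aus.preprojGen]
    exact Aus.unit_mul_of_ne fun h' => h (Fin.ext h')
  | sum_vertex =>
    simp only [map_sum, map_one, FreeAlgebra.lift_ι_apply, Aus.preprojGen]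
    rw [← Aus.sum_unit hn, Finset.sum_range]
  | arrow a =>
    simp only [map_mul, FreeAlgebra.lift_ι_apply, Aus.preprojGen]
    rw [Aus.unit_mul (by omega) (by omega) (by omega), Aus.unit_mul (by omega) (by omega) (by omega)]
  | opp a =>
    simp only [map_mul, FreeAlgebra.lift_ι_apply, Aus.preprojGen]
    rw [Aus.unit_mul (by omega) (by omega) (by omega), Aus.unit_mul (by omega) (by omega) (by omega)]
  | preproj =>
    simp only [map_sum, map_sub, map_mul, map_zero, FreeAlgebra.lift_ι_apply, Aus.preprojGen]
    have h1 : ∀ a : Fin (n - 1 - 1),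
        Aus.unit k n (a + 1) a 0 * Aus.unit k n a (a + 1) 1 -
          Aus.unit k n a (a + 1) 1 * Aus.unit k n (a + 1) a 0 =
        Aus.unit k n (a + 1) (a + 1) 1 - Aus.unit k n a a 1 := fun a => by
      rw [Aus.unit_mul (by omega) (by omega) (by omega),
        Aus.unit_mul (by omega) (by omega) (by omega)]
    -- The sum telescopes. Its last term factors through `[n]`, and `x` acts as zero on `[1]`.
    rw [Finset.sum_congr rfl fun a _ => h1 a,
      ← Finset.sum_range fun a => Aus.unit k n (a + 1) (a + 1) 1 - Aus.unit k n a a 1,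
      Finset.sum_range_sub fun a => Aus.unit k n a a 1, Aus.unit_eq_zero_of_lt Nat.zero_lt_one,
      sub_zero]
    by_cases h2 : n ≤ 2
    · have : n - 1 - 1 = 0 := by omega
      rw [this, Aus.unit_eq_zero_of_lt Nat.zero_lt_one]
    · exact Aus.unit_eq_zero hn (by omega)

/-- The homomorphism `Π_{n-1} → A_n/⟨e⟩`. -/
def Aus.ofPreproj (hn : 1 ≤ n) : Preproj k (n - 1) →ₐ[k] (Aus k n ⧸ Aus.eIdeal k n) :=
  RingQuot.liftAlgHom k ⟨FreeAlgebra.lift k (Aus.preprojGen k n), Aus.preprojGen_rel hn⟩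

theorem Aus.ofPreproj_mk (hn : 1 ≤ n) (x : PreprojGen (Fin (n - 1)) (Fin (n - 1 - 1))) :
    Aus.ofPreproj hn (Preproj.mk k (n - 1) (.ι k x)) = Aus.preprojGen k n x :=
  (RingQuot.liftAlgHom_mkAlgHom_apply k _ _ _).trans (FreeAlgebra.lift_ι_apply _ _)

theorem Aus.ofPreproj_vert (hn : 1 ≤ n) {i : ℕ} (hi : i < n - 1) :
    Aus.ofPreproj hn (Preproj.vert k (n - 1) i) = Aus.unit k n i i 0 := by
  rw [Preproj.vert_of_lt hi, Aus.ofPreproj_mk]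
  rfl

theorem Aus.ofPreproj_arr (hn : 1 ≤ n) {i : ℕ} (hi : i < n - 1 - 1) :
    Aus.ofPreproj hn (Preproj.arr k (n - 1) i) = Aus.unit k n (i + 1) i 0 := by
  rw [Preproj.arr_of_lt hi, Aus.ofPreproj_mk]
  rfl

theorem Aus.ofPreproj_opp (hn : 1 ≤ n) {i : ℕ} (hi : i < n - 1 - 1) :
    Aus.ofPreproj hn (Preproj.opp k (n - 1) i) = Aus.unit k n i (i + 1) 1 := by
  rw [Preproj.opp_of_lt hi, Aus.ofPreproj_mk]
  rfl

theorem Preproj.vert_mul_arrSum_pow_succ {m : ℕ} (i p : ℕ) :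
    Preproj.vert k m (i + p + 1) * Preproj.arrSum k m ^ (p + 1) =
      Preproj.vert k m (i + p + 1) * Preproj.arrSum k m ^ p * Preproj.arr k m i := by
  rw [mul_assoc, ← Preproj.arrSum_mul_vert, ← mul_assoc (_ ^ p), ← pow_succ,
    Preproj.arrSum_pow_mul_vert, ← mul_assoc, ← add_assoc, Preproj.vert_mul_self]

theorem Aus.ofPreproj_vert_mul_arrSum_pow (hn : 1 ≤ n) (p j : ℕ) (h : j + p < n - 1) :
    Aus.ofPreproj hn (Preproj.vert k (n - 1) (j + p) * Preproj.arrSum k (n - 1) ^ p) =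
      Aus.unit k n (j + p) j 0 := by
  induction p generalizing j with
  | zero => rw [pow_zero, mul_one, add_zero, Aus.ofPreproj_vert hn (by omega)]
  | succ p ih =>
    have h1 := ih (j + 1) (by omega)
    rw [show j + 1 + p = j + p + 1 by omega] at h1
    rw [← add_assoc, Preproj.vert_mul_arrSum_pow_succ, map_mul, h1,
      Aus.ofPreproj_arr hn (by omega), Aus.unit_mul (by omega) (by omega) (by omega)]

theorem Aus.ofPreproj_path (hn : 1 ≤ n) (j p q : ℕ) (h : j + p + q < n - 1) :
    Aus.ofPreproj hn (Preproj.path k (n - 1) (j + p) p q) = Aus.unit k n (j + p) (j + q) q := by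
  induction q with
  | zero =>
    rw [Preproj.path, pow_zero, mul_one]
    exact Aus.ofPreproj_vert_mul_arrSum_pow hn p j (by omega)
  | succ q ih =>
    rw [Preproj.path_succ, map_mul, ih (by omega), Aus.ofPreproj_opp hn (by omega),
      Aus.unit_mul (by omega) (by omega) (by omega), add_assoc]

theorem Aus.ofPreproj_path_of_le (hn : 1 ≤ n) {i p q : ℕ} (hp : p ≤ i) (hq : i + q < n - 1) :
    Aus.ofPreproj hn (Preproj.path k (n - 1) i p q) = Aus.unit k n i (i - p + q) q := by
  have h := Aus.ofPreproj_path (k := k) hn (i - p) p q (by omega)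
  rwa [Nat.sub_add_cancel hp] at h

theorem Aus.ofPreproj_injective (hn : 1 ≤ n) :
    Function.Injective (Aus.ofPreproj (k := k) hn) := by
  rw [injective_iff_map_eq_zero]
  intro z hz
  have hmem : z ∈ Preproj.pathSpan k (n - 1) := by
    rw [Preproj.pathSpan_eq_top]
    exact Submodule.mem_top
  obtain ⟨c, rfl⟩ := Finsupp.mem_span_range_iff_exists_finsupp.mp hmem
  have h := linearIndependent_iff.mp (Aus.linearIndependent_unit (k := k) hn) c <| by
    rw [Finsupp.linearCombination_apply, ← hz, map_finsuppSum]
    refine Finsupp.sum_congr fun t _ => ?_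
    rw [map_smul, Aus.ofPreproj_path_of_le hn t.2.1 t.2.2]
  rw [h, Finsupp.sum_zero_index]

theorem Aus.ofPreproj_surjective (hn : 1 ≤ n) :
    Function.Surjective (Aus.ofPreproj (k := k) hn) := by
  intro z
  refine Aus.mem_of_unit_mem (LinearMap.range (Aus.ofPreproj hn).toLinearMap)
    (fun i j q hi hj hij => ?_) z
  by_cases hq : n ≤ i + q + 1
  · rw [Aus.unit_eq_zero hn hq]
    exact zero_mem _
  by_cases hjq : j < q
  · rw [Aus.unit_eq_zero_of_lt hjq]
    exact zero_mem _
  refine ⟨Preproj.path k (n - 1) i (i + q - j) q, ?_⟩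
  have h := Aus.ofPreproj_path_of_le (k := k) hn (i := i) (p := i + q - j) (q := q) (by omega)
    (by omega)
  rw [show i - (i + q - j) + q = j by omega] at h
  exact h

/-- The isomorphism `Π_{n-1} ≅ A_n/⟨e⟩`. -/
def Aus.preprojEquiv (hn : 1 ≤ n) : Preproj k (n - 1) ≃ₐ[k] (Aus k n ⧸ Aus.eIdeal k n) :=
  AlgEquiv.ofBijective (Aus.ofPreproj hn) ⟨Aus.ofPreproj_injective hn, Aus.ofPreproj_surjective hn⟩

theorem isFiniteLength_preproj (hn : 1 ≤ n) :
    IsFiniteLength (Preproj k (n - 1)) (Preproj k (n - 1)) := by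
  let E : FLMod (Lam k n) := FLMod.of (Gen k n)
    (isFiniteLength_iff_isNoetherian_isArtinian.mpr ⟨inferInstance, inferInstance⟩)
  let ψ : Aus k n →+* Preproj k (n - 1) :=
    (Aus.preprojEquiv (k := k) hn).symm.toRingEquiv.toRingHom.comp (Ideal.Quotient.mk _)
  have hψ : Function.Surjective ψ :=
    (Aus.preprojEquiv (k := k) hn).symm.surjective.comp Ideal.Quotient.mk_surjective
  have : RingHomSurjective ψ := ⟨hψ⟩
  let f : (Gen k n →ₗ[Lam k n] Gen k n) →ₛₗ[ψ] Preproj k (n - 1) :=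
    { toFun := fun g => ψ (MulOpposite.op g)
      map_add' := fun g h => map_add ψ (MulOpposite.op g) (MulOpposite.op h)
      map_smul' := fun a g => map_mul ψ a (MulOpposite.op g) }
  exact isFiniteLength_of_surjective f (hψ.comp MulOpposite.op_surjective)
    (isFiniteLength_hom k n E)

end Comparison

end SubmodPreproj

end

theorem theorem2 (k : Type u) [Field k] (n : ℕ) (hn : 1 ≤ n) :
    Nonempty (SubmodPreproj.Preproj k (n - 1) ≃ₐ[k]
      (SubmodPreproj.Aus k n ⧸ SubmodPreproj.Aus.eIdeal k n)) ∧
    (∀ M : SubmodPreproj.FLMod (SubmodPreproj.Preproj k (n - 1)),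
      Nonempty (SubmodPreproj.ProjCover M)) ∧
    ∀ (φ : SubmodPreproj.Preproj k (n - 1) ≃ₐ[k]
        (SubmodPreproj.Aus k n ⧸ SubmodPreproj.Aus.eIdeal k n))
      (c : ∀ M : SubmodPreproj.FLMod (SubmodPreproj.Preproj k (n - 1)),
        SubmodPreproj.ProjCover M),
      Nonempty (SubmodPreproj.functorF k n φ ⋙ SubmodPreproj.stableProj _ ≅
        SubmodPreproj.functorG k n φ ⋙ SubmodPreproj.stableProj _ ⋙
          SubmodPreproj.syzygy c) :=
  ⟨⟨SubmodPreproj.Aus.preprojEquiv hn⟩,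
    SubmodPreproj.nonempty_projCover (SubmodPreproj.isFiniteLength_preproj hn),
    fun φ => SubmodPreproj.nonempty_iso_syzygy _ _ (SubmodPreproj.presFG hn φ)
      (SubmodPreproj.covers_presFG hn φ)⟩
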